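/- An instance of the two-dimensional generalized minimum Manhattan network problem (2D-GMMN) is a finite list $R$ of $n$ pairs of points (terminals) in $\mathbb{R}^2$. A feasible solution is a rectilinear network, that is, a finite collection $N$ of axis-parallel line segments, which contains for every pair $(t,t')\in R$ an M-path, that is, a path from $t$ to $t'$ that consists of axis-parallel segments and whose total length is the Manhattan distance $\|t-t'\|_1$. The cost $\|N\|$ of a network is the total length of its segments, and $\mathrm{opt}(R)$ is the infimum of the costs of the feasible solutions of $R$. Then 2D-GMMN admits a polynomial-time $O(\log^2 n)$-approximation: there are a function $\rho:\mathbb{N}\to\mathbb{R}$ with $\rho(n)=O(\log^2 n)$ as $n\to\infty$, a polynomial $T$, and an algorithm that, for every $n\ge 0$ and every instance $R$ with $n$ terminal pairs, halts after at most $T(n)$ steps with a feasible solution $N$ of cost $\|N\|\le\rho(n)\cdot\mathrm{opt}(R)$. Here the algorithm is one fixed program for a real random access machine, which at unit cost stores, adds, subtracts and compares real numbers and stores, adds, subtracts, halves and compares natural numbers, the latter being used also as addresses. -/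

import Mathlib

open Filter Asymptotics

namespace GMMN

/-! ### Rectilinear networks and Manhattan paths in the plane -/

/-- Points of the plane. -/
abbrev Pt : Type := ℝ × ℝ

/-- The Manhattan distance of two points. -/
noncomputable def manhattan (p q : Pt) : ℝ := |p.1 - q.1| + |p.2 - q.2|

/-- The segment between `p` and `q` is vertical or horizontal (it may be a single point). -/
def AxisParallel (p q : Pt) : Prop := p.1 = q.1 ∨ p.2 = q.2

/-- A finite list of segments, each given by its two endpoints. -/
abbrev Network : Type := List (Pt × Pt)

/-- All segments of the network are axis-parallel. -/
def Network.IsRectilinear (N : Network) : Prop := ∀ s ∈ N, AxisParallel s.1 s.2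

/-- The set of points covered by the network. -/
def Network.carrier (N : Network) : Set Pt := ⋃ s ∈ N, segment ℝ s.1 s.2

/-- The total length of the segments (for an axis-parallel segment, the Manhattan distance of its
endpoints is its length). -/
noncomputable def Network.length (N : Network) : ℝ := (N.map fun s => manhattan s.1 s.2).sum

/-- The sum of the distances of consecutive points of a polygonal path. -/
noncomputable def pathLength : List Pt → ℝ
  | [] => 0
  | [_] => 0
  | p :: q :: l => manhattan p q + pathLength (q :: l)

/-- The polygonal path with vertex list `l` is an M-path (Manhattan path) from `t` to `t'` inside
the network `N`: it runs from `t` to `t'`, it consists of axis-parallel segments that are covered by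
the network, and its total length is the Manhattan distance of `t` and `t'`. -/
def IsMPath (N : Network) (t t' : Pt) (l : List Pt) : Prop :=
  l.head? = some t ∧ l.getLast? = some t' ∧
    l.IsChain (fun p q => AxisParallel p q ∧ segment ℝ p q ⊆ N.carrier) ∧
    pathLength l = manhattan t t'

/-- The network M-connects `t` and `t'`. -/
def MConnected (N : Network) (t t' : Pt) : Prop := ∃ l, IsMPath N t t' l

/-- An instance of the generalized minimum Manhattan network problem in the plane:
a finite list of terminal pairs. -/
abbrev Instance : Type := List (Pt × Pt)

/-- The feasible solutions of an instance: rectilinear networks that M-connect every pair. -/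
def Feasible (R : Instance) (N : Network) : Prop :=
  N.IsRectilinear ∧ ∀ r ∈ R, MConnected N r.1 r.2

/-! ### A real random access machine

The memory consists of arrays of natural numbers and of arrays of real numbers, numbered by `ℕ`
(a program mentions only finitely many), and of a write-only output list of segments.
Numbers are only added, subtracted and compared, and natural numbers are also halved; there is no
multiplication, no rounding of reals, and no conversion between reals and naturals.
Each executed assignment, output or test is one step. (A program is a fixed finite text, so its
expressions have constant size.) -/

/-- Natural-number expressions; `get a i` is the entry `i` of the natural-number array `a`. -/
inductive NatExp : Type
  | const (c : ℕ)
  | get (a : ℕ) (i : NatExp)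
  | add (e f : NatExp)
  | sub (e f : NatExp)
  | half (e : NatExp)

/-- Real expressions; `get a i` is the entry `i` of the real array `a`. -/
inductive RealExp : Type
  | const (c : ℕ)
  | get (a : ℕ) (i : NatExp)
  | add (e f : RealExp)
  | sub (e f : RealExp)

/-- Tests. -/
inductive Test : Type
  | natLe (e f : NatExp)
  | realLe (e f : RealExp)
  | not (b : Test)
  | and (b c : Test)

/-- Programs. -/
inductive Program : Type
  | skip
  | setNat (a : ℕ) (i e : NatExp)
  | setReal (a : ℕ) (i : NatExp) (e : RealExp)
  | emit (x y x' y' : RealExp)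
  | seq (P Q : Program)
  | ite (b : Test) (P Q : Program)
  | while (b : Test) (P : Program)

/-- The memory of the machine: `nat a i` and `real a i` are the entries `i` of the arrays
number `a`, and `out` is the list of segments output so far. -/
structure Memory : Type where
  nat : ℕ → ℕ → ℕ
  real : ℕ → ℕ → ℝ
  out : List (Pt × Pt)

/-- The value of a natural-number expression (subtraction is truncated at `0`). -/
def NatExp.eval (s : Memory) : NatExp → ℕ
  | .const c => c
  | .get a i => s.nat a (i.eval s)
  | .add e f => e.eval s + f.eval s
  | .sub e f => e.eval s - f.eval s
  | .half e => e.eval s / 2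

/-- The value of a real expression. -/
noncomputable def RealExp.eval (s : Memory) : RealExp → ℝ
  | .const c => (c : ℝ)
  | .get a i => s.real a (i.eval s)
  | .add e f => e.eval s + f.eval s
  | .sub e f => e.eval s - f.eval s

/-- The truth value of a test. -/
def Test.Holds (s : Memory) : Test → Prop
  | .natLe e f => e.eval s ≤ f.eval s
  | .realLe e f => e.eval s ≤ f.eval s
  | .not b => ¬ b.Holds s
  | .and b c => b.Holds s ∧ c.Holds s

/-- Overwrite one entry of a natural-number array. -/
def Memory.setNat (s : Memory) (a i v : ℕ) : Memory :=
  { s with nat := Function.update s.nat a (Function.update (s.nat a) i v) }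

/-- Overwrite one entry of a real array. -/
noncomputable def Memory.setReal (s : Memory) (a i : ℕ) (v : ℝ) : Memory :=
  { s with real := Function.update s.real a (Function.update (s.real a) i v) }

/-- Append a segment to the output. -/
def Memory.emit (s : Memory) (g : Pt × Pt) : Memory := { s with out := s.out ++ [g] }

/-- `Exec P s s' k`: the program `P`, started in memory `s`, halts in memory `s'` after exactly
`k` steps. -/
inductive Exec : Program → Memory → Memory → ℕ → Prop
  | skip (s : Memory) : Exec .skip s s 1
  | setNat (s : Memory) (a : ℕ) (i e : NatExp) :
      Exec (.setNat a i e) s (s.setNat a (i.eval s) (e.eval s)) 1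
  | setReal (s : Memory) (a : ℕ) (i : NatExp) (e : RealExp) :
      Exec (.setReal a i e) s (s.setReal a (i.eval s) (e.eval s)) 1
  | emit (s : Memory) (x y x' y' : RealExp) :
      Exec (.emit x y x' y') s (s.emit ((x.eval s, y.eval s), (x'.eval s, y'.eval s))) 1
  | seq {P Q : Program} {s s' s'' : Memory} {k l : ℕ} :
      Exec P s s' k → Exec Q s' s'' l → Exec (.seq P Q) s s'' (k + l)
  | ite_true {b : Test} {P Q : Program} {s s' : Memory} {k : ℕ} :
      b.Holds s → Exec P s s' k → Exec (.ite b P Q) s s' (k + 1)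
  | ite_false {b : Test} {P Q : Program} {s s' : Memory} {k : ℕ} :
      ¬ b.Holds s → Exec Q s s' k → Exec (.ite b P Q) s s' (k + 1)
  | while_true {b : Test} {P : Program} {s s' s'' : Memory} {k l : ℕ} :
      b.Holds s → Exec P s s' k → Exec (.while b P) s' s'' l →
        Exec (.while b P) s s'' (k + l + 1)
  | while_false {b : Test} {P : Program} {s : Memory} :
      ¬ b.Holds s → Exec (.while b P) s s 1

/-- The initial memory on input `R`: entry `0` of the natural-number array `0` is the number of
terminal pairs, and the entries `i` of the real arrays `0`, `1`, `2`, `3` are the coordinates of the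
two terminals of the `i`-th pair. Everything else is `0`, and the output is empty. -/
noncomputable def initial (R : Instance) : Memory where
  nat a i := if a = 0 ∧ i = 0 then R.length else 0
  real a i :=
    let r : Pt × Pt := R.getD i ((0, 0), (0, 0))
    match a with
    | 0 => r.1.1
    | 1 => r.1.2
    | 2 => r.2.1
    | 3 => r.2.2
    | _ => 0
  out := []

/-! ### Approximation algorithms -/

/-- The program `P` is a `ρ(n)`-approximation algorithm whose running time is bounded by the
polynomial `T`, `n` being the number of terminal pairs: on every instance it halts within `T(n)`
steps, and its output is a feasible network whose length is at most `ρ(n)` times the length of any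
feasible network. -/
def IsApproximationAlgorithm (P : Program) (T : Polynomial ℕ) (ρ : ℕ → ℝ) : Prop :=
  ∀ R : Instance, ∃ (s : Memory) (k : ℕ),
    Exec P (initial R) s k ∧ k ≤ T.eval R.length ∧
      Feasible R s.out ∧
      ∀ N : Network, Feasible R N → Network.length s.out ≤ ρ R.length * N.length

/-- The problem admits a (polynomial-time) `ρ(n)`-approximation. -/
def AdmitsApproximation (ρ : ℕ → ℝ) : Prop :=
  ∃ (P : Program) (T : Polynomial ℕ), IsApproximationAlgorithm P T ρ

end GMMN

/-! Every pair is listed in both orders, which gives m = 2n items, each with a first and a second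
terminal. In each coordinate a binary tree over the ranks assigns an item to the lowest node that
contains the ranks of both its terminals. Unless the node is a leaf, an item has ranks in both
children; hence the intervals of the items of one node meet pairwise (`Axis.Valid.min_le_max`), and
by Helly's theorem on the line they share a point, namely the largest left end. Items with the same
nodes and the same orientations in both coordinates form a group. A group has a centre that lies in
the bounding box of each of its items, with the first terminals in one quadrant and the second
terminals in the opposite one. It therefore suffices to join every first terminal to its centre by a
monotone path: an item and its reversal have the same centre, and their two paths together form an
M-path.

What remains is a Steiner arborescence problem for each group. It is solved greedily for all groups
at once: two active items of a group are replaced by the coordinatewise minimum of their positions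
relative to the centre, the pair being chosen so that this minimum is as far from the centre as
possible. All links are monotone, so the cost is the integral over z of the number of active items
at distance at least z once no merge at distance z or more is left (`Reach.cost`).

For the lower bound, an M-path of any feasible network N stays in the bounding box of its ends,
hence in the box of its tree nodes, and it must pass the distance z on its way to the centre
(`exists_crossing`). Such crossings yield points (x, z - x) of the antidiagonal that are dominated
by the terminals. By the invariants of the greedy algorithm, the active items of a group number at
most four times these points (`MergeInv.card_le`). With K = log₂ m + 2 levels, a point of N lies in
the boxes of at most 4K² groups (`sum_paramSet_le`), and crossings are of three kinds. Integration
over z gives the ratio 4 · 3 · 4K² = 48K² (`Reach.length_le`).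

The algorithm needs only comparisons, additions, subtractions and halving. Its correctness and
running time are derived in a small Hoare calculus with step counts (`Runs`). -/

namespace GMMN

/-! ### Total correctness with running time -/

/-- The numbers of the natural-number arrays to which a program may write. -/
def Program.natWrites : Program → List ℕ
  | .setNat a _ _ => [a]
  | .seq P Q => P.natWrites ++ Q.natWrites
  | .ite _ P Q => P.natWrites ++ Q.natWrites
  | .while _ P => P.natWrites
  | _ => []

/-- The numbers of the real arrays to which a program may write. -/
def Program.realWrites : Program → List ℕ
  | .setReal a _ _ => [a]
  | .seq P Q => P.realWrites ++ Q.realWrites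
  | .ite _ P Q => P.realWrites ++ Q.realWrites
  | .while _ P => P.realWrites
  | _ => []

/-- Whether a program contains an output instruction. -/
def Program.emits : Program → Bool
  | .emit _ _ _ _ => true
  | .seq P Q => P.emits || Q.emits
  | .ite _ P Q => P.emits || Q.emits
  | .while _ P => P.emits
  | _ => false

/-- The parts of the memory that `P` does not mention on its left-hand sides agree. -/
structure Program.Frame (P : Program) (s s' : Memory) : Prop where
  nat : ∀ a ∉ P.natWrites, s'.nat a = s.nat a
  real : ∀ a ∉ P.realWrites, s'.real a = s.real a
  out : P.emits = false → s'.out = s.out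

@[simp] theorem Memory.setNat_nat (s : Memory) (a i v b : ℕ) :
    (s.setNat a i v).nat b = if b = a then Function.update (s.nat a) i v else s.nat b := by
  simp [Memory.setNat, Function.update_apply]

@[simp] theorem Memory.setNat_real (s : Memory) (a i v : ℕ) :
    (s.setNat a i v).real = s.real := rfl

@[simp] theorem Memory.setNat_out (s : Memory) (a i v : ℕ) :
    (s.setNat a i v).out = s.out := rfl

@[simp] theorem Memory.setReal_real (s : Memory) (a i : ℕ) (v : ℝ) (b : ℕ) :
    (s.setReal a i v).real b = if b = a then Function.update (s.real a) i v else s.real b := by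
  simp [Memory.setReal, Function.update_apply]

@[simp] theorem Memory.setReal_nat (s : Memory) (a i : ℕ) (v : ℝ) :
    (s.setReal a i v).nat = s.nat := rfl

@[simp] theorem Memory.setReal_out (s : Memory) (a i : ℕ) (v : ℝ) :
    (s.setReal a i v).out = s.out := rfl

@[simp] theorem Memory.emit_nat (s : Memory) (g : Pt × Pt) : (s.emit g).nat = s.nat := rfl

@[simp] theorem Memory.emit_real (s : Memory) (g : Pt × Pt) : (s.emit g).real = s.real := rfl

@[simp] theorem Memory.emit_out (s : Memory) (g : Pt × Pt) :
    (s.emit g).out = s.out ++ [g] := rfl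

/-- Correctness proofs recover every untouched array from this fact, by computing the syntactic
write sets. -/
theorem Exec.frame {P : Program} {s s' : Memory} {k : ℕ} (h : Exec P s s' k) : P.Frame s s' := by
  induction h with
  | skip s => exact ⟨fun _ _ => rfl, fun _ _ => rfl, fun _ => rfl⟩
  | setNat s a i e =>
    refine ⟨fun b hb => ?_, fun _ _ => rfl, fun _ => rfl⟩
    simp only [Program.natWrites, List.mem_singleton] at hb
    simp [hb]
  | setReal s a i e =>
    refine ⟨fun _ _ => rfl, fun b hb => ?_, fun _ => rfl⟩
    simp only [Program.realWrites, List.mem_singleton] at hb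
    simp [hb]
  | emit => exact ⟨fun _ _ => rfl, fun _ _ => rfl, fun h => by simp [Program.emits] at h⟩
  | seq _ _ ih ih' =>
    refine ⟨fun a ha => ?_, fun a ha => ?_, fun ha => ?_⟩
    · simp only [Program.natWrites, List.mem_append, not_or] at ha
      rw [ih'.nat a ha.2, ih.nat a ha.1]
    · simp only [Program.realWrites, List.mem_append, not_or] at ha
      rw [ih'.real a ha.2, ih.real a ha.1]
    · simp only [Program.emits, Bool.or_eq_false_iff] at ha
      rw [ih'.out ha.2, ih.out ha.1]
  | ite_true _ _ ih =>
    refine ⟨fun a ha => ?_, fun a ha => ?_, fun ha => ?_⟩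
    · simp only [Program.natWrites, List.mem_append, not_or] at ha
      exact ih.nat a ha.1
    · simp only [Program.realWrites, List.mem_append, not_or] at ha
      exact ih.real a ha.1
    · simp only [Program.emits, Bool.or_eq_false_iff] at ha
      exact ih.out ha.1
  | ite_false _ _ ih =>
    refine ⟨fun a ha => ?_, fun a ha => ?_, fun ha => ?_⟩
    · simp only [Program.natWrites, List.mem_append, not_or] at ha
      exact ih.nat a ha.2
    · simp only [Program.realWrites, List.mem_append, not_or] at ha
      exact ih.real a ha.2
    · simp only [Program.emits, Bool.or_eq_false_iff] at ha
      exact ih.out ha.2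
  | while_true _ _ _ ih ih' =>
    exact ⟨fun a ha => (ih'.nat a ha).trans (ih.nat a ha),
      fun a ha => (ih'.real a ha).trans (ih.real a ha), fun ha => (ih'.out ha).trans (ih.out ha)⟩
  | while_false => exact ⟨fun _ _ => rfl, fun _ _ => rfl, fun _ => rfl⟩

/-- Started in `s`, the program `P` halts within `T` steps in a memory that satisfies `Q`. -/
def Runs (P : Program) (s : Memory) (T : ℕ) (Q : Memory → Prop) : Prop :=
  ∃ s' k, Exec P s s' k ∧ k ≤ T ∧ Q s'

namespace Runs

variable {P P' : Program} {s : Memory} {T T' : ℕ} {Q Q' : Memory → Prop}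

theorem mono (h : Runs P s T Q) (hT : T ≤ T') (hQ : ∀ s', P.Frame s s' → Q s' → Q' s') :
    Runs P s T' Q' := by
  obtain ⟨s', k, he, hk, hq⟩ := h
  exact ⟨s', k, he, hk.trans hT, hQ s' he.frame hq⟩

theorem skip (h : Q s) : Runs .skip s 1 Q := ⟨s, 1, .skip s, le_rfl, h⟩

theorem setNat {a : ℕ} {i e : NatExp} (h : Q (s.setNat a (i.eval s) (e.eval s))) :
    Runs (.setNat a i e) s 1 Q := ⟨_, 1, .setNat s a i e, le_rfl, h⟩

theorem setReal {a : ℕ} {i : NatExp} {e : RealExp} (h : Q (s.setReal a (i.eval s) (e.eval s))) :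
    Runs (.setReal a i e) s 1 Q := ⟨_, 1, .setReal s a i e, le_rfl, h⟩

theorem emit {x y x' y' : RealExp}
    (h : Q (s.emit ((x.eval s, y.eval s), (x'.eval s, y'.eval s)))) :
    Runs (.emit x y x' y') s 1 Q := ⟨_, 1, .emit s x y x' y', le_rfl, h⟩

theorem seq (h : Runs P s T fun s' => Runs P' s' T' Q) : Runs (.seq P P') s (T + T') Q := by
  obtain ⟨s', k, he, hk, s'', k', he', hk', hq⟩ := h
  exact ⟨s'', k + k', .seq he he', by omega, hq⟩

theorem setNat_seq {a : ℕ} {i e : NatExp} (h : Runs P (s.setNat a (i.eval s) (e.eval s)) T Q) :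
    Runs (.seq (.setNat a i e) P) s (T + 1) Q :=
  (seq (setNat h)).mono (by omega) fun _ _ h => h

theorem setReal_seq {a : ℕ} {i : NatExp} {e : RealExp}
    (h : Runs P (s.setReal a (i.eval s) (e.eval s)) T Q) :
    Runs (.seq (.setReal a i e) P) s (T + 1) Q :=
  (seq (setReal h)).mono (by omega) fun _ _ h => h

theorem emit_seq {x y x' y' : RealExp}
    (h : Runs P (s.emit ((x.eval s, y.eval s), (x'.eval s, y'.eval s))) T Q) :
    Runs (.seq (.emit x y x' y') P) s (T + 1) Q :=
  (seq (emit h)).mono (by omega) fun _ _ h => h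

theorem ite {b : Test} (h : b.Holds s → Runs P s T Q) (h' : ¬ b.Holds s → Runs P' s T Q) :
    Runs (.ite b P P') s (T + 1) Q := by
  by_cases hb : b.Holds s
  · obtain ⟨s', k, he, hk, hq⟩ := h hb
    exact ⟨s', k + 1, .ite_true hb he, by omega, hq⟩
  · obtain ⟨s', k, he, hk, hq⟩ := h' hb
    exact ⟨s', k + 1, .ite_false hb he, by omega, hq⟩

/-- Each round costs the body and one test and lowers the potential; one last test fails. -/
theorem whileLoop {b : Test} (I : Memory → Prop) (μ : Memory → ℕ)
    (step : ∀ s, I s → b.Holds s → Runs P s T fun s' => I s' ∧ μ s' < μ s) (h : I s) :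
    Runs (.while b P) s (μ s * (T + 1) + 1) fun s' => I s' ∧ ¬ b.Holds s' := by
  induction hn : μ s using Nat.strong_induction_on generalizing s with
  | _ n ih =>
    by_cases hb : b.Holds s
    · obtain ⟨s', k, he, hk, hI, hμ⟩ := step s h hb
      obtain ⟨s'', k', he', hk', hq⟩ := ih (μ s') (hn ▸ hμ) hI rfl
      refine ⟨s'', k + k' + 1, .while_true hb he he', ?_, hq⟩
      have : (μ s' + 1) * (T + 1) ≤ n * (T + 1) := Nat.mul_le_mul_right _ (hn ▸ hμ)
      have : (μ s' + 1) * (T + 1) = μ s' * (T + 1) + (T + 1) := by ring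
      omega
    · exact ⟨s, 1, .while_false hb, by omega, h, hb⟩

end Runs

/-! ### Counting loops -/

/-- The entry `0` of an array, used as a scalar variable. -/
abbrev NatExp.var (a : ℕ) : NatExp := .get a (.const 0)

/-- The entry `0` of an array, used as a scalar variable. -/
abbrev RealExp.var (a : ℕ) : RealExp := .get a (.const 0)

/-- Assignment to a scalar variable. -/
abbrev Program.setVar (a : ℕ) (e : NatExp) : Program := .setNat a (.const 0) e

/-- Assignment to a scalar variable. -/
abbrev Program.setRealVar (a : ℕ) (e : RealExp) : Program := .setReal a (.const 0) e

/-- Run the body with the variable `i` counting from `0` to the value of the variable `b`. -/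
def Program.forLoop (i b : ℕ) (body : Program) : Program :=
  .seq (.setVar i (.const 0))
    (.while (.not (.natLe (.var b) (.var i)))
      (.seq body (.setVar i (.add (.var i) (.const 1)))))

/-- The invariant is indexed by the counter and is required after the increment. A round costs the
body, the increment and the test, hence `T + 2`. The step may also use the frame relative to the
memory at loop entry, so facts about constant arrays need not enter the invariant. -/
theorem Runs.forLoop {i b m T : ℕ} {body : Program} {s : Memory} (I : ℕ → Memory → Prop)
    (hi : i ∉ body.natWrites) (hb : b ∉ i :: body.natWrites) (hm : s.nat b 0 = m)
    (h0 : I 0 (s.setNat i 0 0))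
    (step : ∀ k < m, ∀ s', (Program.forLoop i b body).Frame s s' → s'.nat i 0 = k → I k s' →
      Runs body s' T fun s'' => I (k + 1) (s''.setNat i 0 (k + 1))) :
    Runs (.forLoop i b body) s (m * (T + 2) + 2) (I m) := by
  have hb' : b ≠ i ∧ b ∉ body.natWrites := by simpa using hb
  have key := Runs.whileLoop (b := .not (.natLe (.var b) (.var i)))
    (P := .seq body (.setVar i (.add (.var i) (.const 1)))) (T := T + 1)
    (s := s.setNat i 0 0)
    (fun s' => (Program.forLoop i b body).Frame s s' ∧ s'.nat i 0 ≤ m ∧ I (s'.nat i 0) s')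
    (fun s' => m - s'.nat i 0) ?_ ?_
  · refine (Runs.seq (T' := m * (T + 2) + 1) (Runs.setNat (key.mono ?_ ?_))).mono ?_
      fun _ _ h => h
    · simp [add_assoc]
    · rintro s' - ⟨⟨hF, hle, hI⟩, hn⟩
      have hbm : s'.nat b 0 = m := by
        rw [hF.nat b (by simp [Program.forLoop, Program.natWrites, hb']), hm]
      simp only [Test.Holds, NatExp.eval, not_not, hbm] at hn
      rwa [le_antisymm hle hn] at hI
    · omega
  · rintro s' ⟨hF, hle, hI⟩ hn
    have hbm : s'.nat b 0 = m := by
      rw [hF.nat b (by simp [Program.forLoop, Program.natWrites, hb']), hm]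
    simp only [Test.Holds, NatExp.eval, hbm, not_le] at hn
    refine Runs.seq ((step _ hn s' hF rfl hI).mono le_rfl fun s'' hF' h => Runs.setNat ?_)
    have hi' : s''.nat i = s'.nat i := hF'.nat i hi
    simp only [NatExp.eval, hi']
    refine ⟨⟨⟨fun a ha => ?_, fun a ha => ?_, fun ha => ?_⟩, ?_, ?_⟩, ?_⟩
    · have ha' := ha
      simp only [Program.forLoop, Program.natWrites, List.cons_append, List.nil_append, List.mem_cons,
        List.mem_append, List.not_mem_nil, or_false, not_or] at ha'
      simp [ha'.1, hF'.nat a ha'.2.1, hF.nat a ha]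
    · have ha' := ha
      simp only [Program.forLoop, Program.realWrites, List.nil_append, List.append_nil] at ha'
      simp [hF'.real a ha', hF.real a ha]
    · have ha' := ha
      simp only [Program.forLoop, Program.emits, Bool.or_false, Bool.false_or] at ha'
      simp [hF'.out ha', hF.out ha]
    · simpa using hn
    · simpa using h
    · simp; omega
  · refine ⟨⟨fun a ha => ?_, fun a ha => rfl, fun ha => rfl⟩, ?_, ?_⟩
    · simp only [Program.forLoop, Program.natWrites, List.cons_append, List.nil_append, List.mem_cons,
        List.mem_append, List.not_mem_nil, or_false, not_or] at ha
      simp [ha.1]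
    · simp
    · simpa using h0

/-! ### Manhattan paths -/

theorem manhattan_comm (p q : Pt) : manhattan p q = manhattan q p := by
  simp [manhattan, abs_sub_comm]

theorem manhattan_nonneg (p q : Pt) : 0 ≤ manhattan p q := by
  unfold manhattan; positivity

theorem manhattan_triangle (p q r : Pt) : manhattan p r ≤ manhattan p q + manhattan q r := by
  have h1 := abs_sub_le p.1 q.1 r.1
  have h2 := abs_sub_le p.2 q.2 r.2
  unfold manhattan; linarith

theorem manhattan_self (p : Pt) : manhattan p p = 0 := by simp [manhattan]

theorem abs_sub_add_abs_sub_of_mem_segment {a b x : ℝ} (h : x ∈ segment ℝ a b) :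
    |a - x| + |x - b| = |a - b| := by
  obtain ⟨s, t, hs, ht, hst, rfl⟩ := h
  obtain rfl : s = 1 - t := by linarith
  simp only [smul_eq_mul]
  rw [show a - ((1 - t) * a + t * b) = t * (a - b) by ring,
    show (1 - t) * a + t * b - b = (1 - t) * (a - b) by ring, abs_mul, abs_mul,
    abs_of_nonneg ht, abs_of_nonneg hs]
  ring

theorem manhattan_add_of_mem_segment {p q w : Pt} (h : w ∈ segment ℝ p q) :
    manhattan p w + manhattan w q = manhattan p q := by
  obtain ⟨s, t, hs, ht, hst, rfl⟩ := h
  have h1 := abs_sub_add_abs_sub_of_mem_segment (a := p.1) (b := q.1) ⟨s, t, hs, ht, hst, rfl⟩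
  have h2 := abs_sub_add_abs_sub_of_mem_segment (a := p.2) (b := q.2) ⟨s, t, hs, ht, hst, rfl⟩
  simp only [manhattan, Prod.fst_add, Prod.snd_add, Prod.smul_fst, Prod.smul_snd]
  linarith

theorem mem_uIcc_of_abs_sub_add {a b x : ℝ} (h : |a - x| + |x - b| ≤ |a - b|) :
    x ∈ Set.uIcc a b := by
  rw [Set.mem_uIcc]
  rcases le_total a b with hab | hab
  · left
    rw [abs_of_nonpos (by linarith : a - b ≤ 0)] at h
    exact ⟨by linarith [neg_abs_le (x - b), le_abs_self (x - b), le_abs_self (a - x)],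
      by linarith [neg_abs_le (a - x), le_abs_self (x - b)]⟩
  · right
    rw [abs_of_nonneg (by linarith : 0 ≤ a - b)] at h
    exact ⟨by linarith [neg_abs_le (x - b), le_abs_self (a - x)],
      by linarith [neg_abs_le (a - x), le_abs_self (x - b)]⟩

theorem mem_uIcc_of_manhattan_add {p q w : Pt}
    (h : manhattan p w + manhattan w q ≤ manhattan p q) :
    w.1 ∈ Set.uIcc p.1 q.1 ∧ w.2 ∈ Set.uIcc p.2 q.2 := by
  have h1 := abs_sub_le p.1 w.1 q.1
  have h2 := abs_sub_le p.2 w.2 q.2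
  unfold manhattan at h
  exact ⟨mem_uIcc_of_abs_sub_add (by linarith), mem_uIcc_of_abs_sub_add (by linarith)⟩

/-- The intermediate value theorem is applied to the edge on which the value is passed; the length
bounds are triangle inequalities. The condition `f t ≠ f t'` excludes the one-vertex path, which
need not meet the network at all. -/
theorem exists_mem_carrier_of_chain {N : Network} {f : Pt → ℝ} (hf : Continuous f) {t' : Pt}
    {z : ℝ} : ∀ (l : List Pt) {t : Pt}, l.head? = some t → l.getLast? = some t' →
      l.IsChain (fun p q => AxisParallel p q ∧ segment ℝ p q ⊆ N.carrier) →
      z ∈ Set.uIcc (f t) (f t') → f t ≠ f t' →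
      ∃ w ∈ N.carrier, f w = z ∧ manhattan t w + manhattan w t' ≤ pathLength l ∧
        manhattan t t' ≤ pathLength l
  | [], t, h, _, _, _, _ => by simp at h
  | [p], t, h, h', _, _, hne => by
    simp only [List.head?_cons, Option.some.injEq, List.getLast?_singleton] at h h'
    exact absurd (by rw [← h, ← h']) hne
  | p :: q :: l, t, h, h', hc, hz, hne => by
    obtain rfl : p = t := by simpa using h
    rw [List.isChain_cons_cons] at hc
    rw [List.getLast?_cons_cons] at h'
    have hlen : ∀ (l : List Pt) {t : Pt}, l.head? = some t → l.getLast? = some t' →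
        manhattan t t' ≤ pathLength l := by
      intro l
      induction l with
      | nil => intro t h; simp at h
      | cons a l ih =>
        intro t h h'
        obtain rfl : a = t := by simpa using h
        cases l with
        | nil =>
          obtain rfl : a = t' := by simpa using h'
          simp [pathLength, manhattan_self]
        | cons b l =>
          have := ih (t := b) rfl (by rwa [List.getLast?_cons_cons] at h')
          have := manhattan_triangle a b t'
          simp only [pathLength]; linarith
    have hq := hlen (q :: l) (t := q) rfl h'
    have htri := manhattan_triangle p q t'
    by_cases hzq : z ∈ Set.uIcc (f p) (f q)
    · have hpre : IsPreconnected (segment ℝ p q) := (convex_segment p q).isPreconnected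
      have : z ∈ f '' segment ℝ p q := by
        rcases Set.mem_uIcc.1 hzq with hh | hh
        · exact hpre.intermediate_value (left_mem_segment ℝ p q) (right_mem_segment ℝ p q)
            hf.continuousOn hh
        · exact hpre.intermediate_value (right_mem_segment ℝ p q) (left_mem_segment ℝ p q)
            hf.continuousOn hh
      obtain ⟨w, hw, rfl⟩ := this
      have h1 := manhattan_add_of_mem_segment hw
      have h2 := manhattan_triangle w q t'
      exact ⟨w, hc.1.2 hw, rfl, by simp only [pathLength]; linarith,
        by simp only [pathLength]; linarith⟩
    -- The first edge misses the value, so the rest of the path passes it. The values at the ends of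
    -- the rest differ, since otherwise `z = f q` would be attained on the first edge.
    · have hz' : z ∈ Set.uIcc (f q) (f t') := by
        simp only [Set.mem_uIcc] at hz hzq ⊢
        grind
      have hne' : f q ≠ f t' := by
        rintro he
        apply hzq
        simp only [Set.mem_uIcc] at hz hz' ⊢
        grind
      obtain ⟨w, hw, hwz, h1, -⟩ :=
        exists_mem_carrier_of_chain hf (q :: l) (t := q) rfl h' hc.2 hz' hne'
      have h2 := manhattan_triangle p q w
      exact ⟨w, hw, hwz, by simp only [pathLength]; linarith, by simp only [pathLength]; linarith⟩

/-- An M-path attains all intermediate values of a continuous function, at points of the bounding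
box of its ends. -/
theorem MConnected.exists_eq {N : Network} {t t' : Pt} (h : MConnected N t t') {f : Pt → ℝ}
    (hf : Continuous f) {z : ℝ} (hz : z ∈ Set.uIcc (f t) (f t')) (hne : f t ≠ f t') :
    ∃ w ∈ N.carrier, f w = z ∧ w.1 ∈ Set.uIcc t.1 t'.1 ∧ w.2 ∈ Set.uIcc t.2 t'.2 := by
  obtain ⟨l, h1, h2, h3, h4⟩ := h
  obtain ⟨w, hw, hwz, h5, -⟩ := exists_mem_carrier_of_chain hf l h1 h2 h3 hz hne
  exact ⟨w, hw, hwz, mem_uIcc_of_manhattan_add (h4 ▸ h5)⟩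

/-- `Joined N p q d`: the network contains a rectilinear path of length `d` from `p` to `q`. -/
inductive Joined (N : Network) : Pt → Pt → ℝ → Prop
  | refl (p : Pt) : Joined N p p 0
  | edge {p q : Pt} : AxisParallel p q → segment ℝ p q ⊆ N.carrier → Joined N p q (manhattan p q)
  | trans {p q r : Pt} {a b : ℝ} : Joined N p q a → Joined N q r b → Joined N p r (a + b)

theorem Joined.symm {N : Network} {p q : Pt} {d : ℝ} (h : Joined N p q d) : Joined N q p d := by
  induction h with
  | refl p => exact .refl p
  | edge h h' =>
    rw [manhattan_comm]
    refine .edge ?_ (by rwa [segment_symm])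
    exact h.imp Eq.symm Eq.symm
  | trans _ _ ih ih' => rw [add_comm]; exact ih'.trans ih

theorem Joined.mono {N N' : Network} (hN : N ⊆ N') {p q : Pt} {d : ℝ} (h : Joined N p q d) :
    Joined N' p q d := by
  induction h with
  | refl p => exact .refl p
  | edge h h' =>
    refine .edge h (h'.trans fun x hx => ?_)
    simp only [Network.carrier, Set.mem_iUnion] at hx ⊢
    obtain ⟨s, hs, hx⟩ := hx
    exact ⟨s, hN hs, hx⟩
  | trans _ _ ih ih' => exact ih.trans ih'

theorem Joined.of_mem {N : Network} {p q : Pt} (h : (p, q) ∈ N) (hpq : AxisParallel p q) :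
    Joined N p q (manhattan p q) := by
  refine .edge hpq fun x hx => ?_
  simp only [Network.carrier, Set.mem_iUnion]
  exact ⟨_, h, hx⟩

theorem pathLength_append (p : Pt) (l' : List Pt) : ∀ l : List Pt,
    pathLength (l ++ p :: l') = pathLength (l ++ [p]) + pathLength (p :: l')
  | [] => by simp [pathLength]
  | [a] => by simp [pathLength]
  | a :: b :: l => by
    have := pathLength_append p l' (b :: l)
    simp only [List.cons_append, pathLength] at this ⊢
    rw [this]; ring

/-- The last vertex is split off from the vertex list so that two lists can be spliced at their
common vertex without repeating it. -/
theorem Joined.mConnected {N : Network} {p q : Pt} (h : Joined N p q (manhattan p q)) :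
    MConnected N p q := by
  suffices H : ∀ {p q : Pt} {d : ℝ}, Joined N p q d → ∃ l l' : List Pt,
      l' = l ++ [q] ∧ l'.head? = some p ∧
      l'.IsChain (fun p q => AxisParallel p q ∧ segment ℝ p q ⊆ N.carrier) ∧
      pathLength l' = d by
    obtain ⟨l, l', rfl, h1, h2, h3⟩ := H h
    exact ⟨_, h1, by simp, h2, h3⟩
  intro p q d h
  induction h with
  | refl p => exact ⟨[], _, rfl, by simp [pathLength]⟩
  | @edge p q h h' => exact ⟨[p], _, rfl, by simp [pathLength, h, h']⟩
  | @trans p q r a b _ _ ih ih' =>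
    obtain ⟨l, _, rfl, h1, h2, h3⟩ := ih
    obtain ⟨m, m', hm, g1, g2, g3⟩ := ih'
    cases m' with
    | nil => simp at g1
    | cons x m' =>
      obtain rfl : x = q := by simpa using g1
      refine ⟨l ++ m, l ++ x :: m', by rw [hm, List.append_assoc], ?_, ?_, ?_⟩
      · cases l <;> simpa using h1
      · rw [List.isChain_split]; exact ⟨h2, g2⟩
      · rw [pathLength_append, h3, g3]

/-! ### Greedy merging -/

/-- Data for the greedy algorithm: `m` terminals, divided into groups by `key`. The terminal `j` is
the point at distances `u j`, `v j` from the axes through the centre `(cx j, cy j)` of its group,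
in the quadrant given by the signs `sx j`, `sy j`. -/
structure MergeData where
  m : ℕ
  Key : Type
  key : ℕ → Key
  u : ℕ → ℝ
  v : ℕ → ℝ
  cx : ℕ → ℝ
  cy : ℕ → ℝ
  sx : ℕ → ℝ
  sy : ℕ → ℝ

namespace MergeData

/-- The point with coordinates `a`, `b` relative to the quadrant of item `j`. -/
def pos (D : MergeData) (j : ℕ) (a b : ℝ) : Pt := (D.cx j + D.sx j * a, D.cy j + D.sy j * b)

/-- An L-shaped connection of two points of a quadrant. -/
def link (D : MergeData) (j : ℕ) (a b a' b' : ℝ) : Network :=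
  [(D.pos j a b, D.pos j a' b), (D.pos j a' b, D.pos j a' b')]

/-- The last field says that a group has one centre and one quadrant, so that a merged position is
the same point for both items. -/
structure Valid (D : MergeData) : Prop where
  u_nonneg : ∀ j < D.m, 0 ≤ D.u j
  v_nonneg : ∀ j < D.m, 0 ≤ D.v j
  abs_sx : ∀ j < D.m, |D.sx j| = 1
  abs_sy : ∀ j < D.m, |D.sy j| = 1
  pos_congr : ∀ i < D.m, ∀ j < D.m, D.key i = D.key j → D.pos i = D.pos j

end MergeData

/-- The distance from the centre at which the items `i` and `j` can be merged. -/
noncomputable def gain (u v : ℕ → ℝ) (i j : ℕ) : ℝ := min (u i) (u j) + min (v i) (v j)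

theorem gain_comm (u v : ℕ → ℝ) (i j : ℕ) : gain u v i j = gain u v j i := by
  simp [gain, min_comm]

/-- `i` and `j` are distinct active items of the same group. -/
def MergeData.Mergeable (D : MergeData) (al : Finset ℕ) (i j : ℕ) : Prop :=
  i ∈ al ∧ j ∈ al ∧ i ≠ j ∧ D.key i = D.key j

theorem MergeData.Mergeable.symm {D : MergeData} {al : Finset ℕ} {i j : ℕ}
    (h : D.Mergeable al i j) : D.Mergeable al j i := ⟨h.2.1, h.1, h.2.2.1.symm, h.2.2.2.symm⟩

/-- `Reach D al u v N`: repeatedly merging two active items that can be merged farthest from their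
centre leads to the active items `al` at the positions `u`, `v` and to the network `N`. -/
inductive Reach (D : MergeData) : Finset ℕ → (ℕ → ℝ) → (ℕ → ℝ) → Network → Prop
  | init : Reach D (Finset.range D.m) D.u D.v []
  | step {al : Finset ℕ} {u v : ℕ → ℝ} {N : Network} {i j : ℕ} :
      Reach D al u v N → D.Mergeable al i j →
      (∀ i' j', D.Mergeable al i' j' → gain u v i' j' ≤ gain u v i j) →
      Reach D (al.erase j) (Function.update u i (min (u i) (u j)))
        (Function.update v i (min (v i) (v j)))
        (N ++ (D.link i (u i) (v i) (min (u i) (u j)) (min (v i) (v j)) ++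
          D.link j (u j) (v j) (min (u i) (u j)) (min (v i) (v j))))

/-- Some terminal of the group `g` has first coordinate `x` and second coordinate in `[y, y')`. -/
def MergeData.Touch (D : MergeData) (a b : ℕ → ℝ) (g : D.Key) (x y y' : ℝ) : Prop :=
  ∃ t < D.m, D.key t = g ∧ a t = x ∧ y ≤ b t ∧ b t < y'

theorem MergeData.Touch.mono {D : MergeData} {a b : ℕ → ℝ} {g : D.Key} {x y y' w : ℝ}
    (h : D.Touch a b g x y y') (hw : w ≤ y) : D.Touch a b g x w y' := by
  obtain ⟨t, h1, h2, h3, h4, h5⟩ := h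
  exact ⟨t, h1, h2, h3, hw.trans h4, h5⟩

/-- If an active item is dominated by another one, then a terminal witnesses its first
coordinate below the other one. -/
def MergeData.DomInv (D : MergeData) (a b : ℕ → ℝ) (al : Finset ℕ) (u v : ℕ → ℝ) : Prop :=
  ∀ p q, D.Mergeable al p q → u q ≤ u p → v q < v p → D.Touch a b (D.key q) (u q) (v q) (v p)

/-- For two incomparable active items a terminal witnesses the outer coordinate of one of them. -/
def MergeData.CrossInv (D : MergeData) (a b : ℕ → ℝ) (al : Finset ℕ) (u v : ℕ → ℝ) : Prop :=
  ∀ p q, D.Mergeable al p q → u p < u q → v q < v p →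
    D.Touch b a (D.key p) (v p) (u p) (u q) ∨ D.Touch a b (D.key p) (u q) (v q) (v p)

/-! ### Preservation of the invariants under a greedy merge -/

section Step

variable {D : MergeData} {a b : ℕ → ℝ} {al : Finset ℕ} {u v : ℕ → ℝ} {i j : ℕ}

theorem mergeable_of_erase {p q : ℕ} (h : D.Mergeable (al.erase j) p q) :
    D.Mergeable al p q ∧ p ≠ j ∧ q ≠ j :=
  ⟨⟨Finset.mem_of_mem_erase h.1, Finset.mem_of_mem_erase h.2.1, h.2.2⟩,
    Finset.ne_of_mem_erase h.1, Finset.ne_of_mem_erase h.2.1⟩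

/-- Here the greedy choice enters the invariants. If `r` is not above `i`, then it is above `j`, and
merging `i` with `r` would gain `u i + v r`, more than the `u i + v j` of the chosen pair. -/
theorem MergeData.DomInv.step_aux (h : D.DomInv a b al u v)
    (hmax : ∀ i' j', D.Mergeable al i' j' → gain u v i' j' ≤ gain u v i j) {r : ℕ}
    (hir : D.Mergeable al i r) (hu : u i ≤ u j) (h1 : u i ≤ u r)
    (h2 : min (v i) (v j) < v r) :
    D.Touch a b (D.key i) (u i) (min (v i) (v j)) (v r) := by
  by_cases hv : v i < v r
  · exact (h r i hir.symm h1 hv).mono (min_le_left _ _)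
  · have := hmax i r hir
    have h3 : v j < v r := by
      rcases min_lt_iff.1 h2 with h' | h'
      · exact absurd h' hv
      · exact h'
    rw [gain, gain, min_eq_left hu, min_eq_left h1, min_eq_right (not_lt.1 hv),
      min_eq_right (by linarith)] at this
    linarith

/-- If the merged item dominates `q`, so does the one of `i` and `j` that supplies its second
coordinate, and the old invariant applies. If the merged item is dominated, `step_aux` applies to
the one that supplies its first coordinate. -/
theorem MergeData.DomInv.step (h : D.DomInv a b al u v) (hij : D.Mergeable al i j)
    (hmax : ∀ i' j', D.Mergeable al i' j' → gain u v i' j' ≤ gain u v i j) :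
    D.DomInv a b (al.erase j) (Function.update u i (min (u i) (u j)))
      (Function.update v i (min (v i) (v j))) := by
  intro p q hpq' h1 h2
  obtain ⟨hpq, hpj, hqj⟩ := mergeable_of_erase hpq'
  by_cases hp : p = i
  · subst hp
    have hqp : q ≠ p := hpq.2.2.1.symm
    simp only [Function.update_self, Function.update_of_ne hqp] at h1 h2 ⊢
    rcases le_total (v p) (v j) with hv | hv
    · rw [min_eq_left hv] at h2 ⊢
      exact h p q hpq (h1.trans (min_le_left _ _)) h2
    · rw [min_eq_right hv] at h2 ⊢
      exact h j q ⟨hij.2.1, hpq.2.1, hqj.symm, hij.2.2.2.symm.trans hpq.2.2.2⟩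
        (h1.trans (min_le_right _ _)) h2
  by_cases hq : q = i
  · subst hq
    simp only [Function.update_self, Function.update_of_ne hp] at h1 h2 ⊢
    rcases le_total (u q) (u j) with hu | hu
    · rw [min_eq_left hu] at h1 ⊢
      exact h.step_aux hmax hpq.symm hu h1 h2
    · rw [min_eq_right hu] at h1 ⊢
      rw [min_comm] at h2 ⊢
      rw [hij.2.2.2]
      exact h.step_aux (fun i' j' hh => (hmax i' j' hh).trans_eq (gain_comm _ _ _ _))
        ⟨hij.2.1, hpq.1, hpj.symm, hij.2.2.2.symm.trans hpq.2.2.2.symm⟩ hu h1 h2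
  simp only [Function.update_of_ne hp, Function.update_of_ne hq] at h1 h2 ⊢
  exact h p q hpq h1 h2

/-- The new case is the merged position `(u i, v j)`. Either `j` and `q` are incomparable, and the
witness interval is only widened, or `j` dominates `q` and the domination invariant gives the second
alternative. -/
theorem MergeData.CrossInv.step_aux (hc : D.CrossInv a b al u v) (hd : D.DomInv a b al u v)
    (hij : D.Mergeable al i j) {q : ℕ} (hiq : D.Mergeable al i q) (hjq : D.Mergeable al j q)
    (hu : u i ≤ u j) (h1 : u i < u q) (h2 : v q < min (v i) (v j)) :
    D.Touch b a (D.key i) (min (v i) (v j)) (u i) (u q) ∨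
      D.Touch a b (D.key i) (u q) (v q) (min (v i) (v j)) := by
  rcases le_total (v i) (v j) with hv | hv
  · rw [min_eq_left hv] at h2 ⊢
    exact hc i q hiq h1 h2
  · rw [min_eq_right hv] at h2 ⊢
    rw [hij.2.2.2]
    rcases lt_or_ge (u j) (u q) with h3 | h3
    · exact (hc j q hjq h3 h2).imp_left fun h => h.mono hu
    · right
      rw [hjq.2.2.2]
      exact hd j q hjq h3 h2

theorem MergeData.CrossInv.step_left (hc : D.CrossInv a b al u v) (hd : D.DomInv a b al u v)
    (hij : D.Mergeable al i j) {q : ℕ} (hiq : D.Mergeable al i q) (hjq : D.Mergeable al j q)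
    (h1 : min (u i) (u j) < u q) (h2 : v q < min (v i) (v j)) :
    D.Touch b a (D.key i) (min (v i) (v j)) (min (u i) (u j)) (u q) ∨
      D.Touch a b (D.key i) (u q) (v q) (min (v i) (v j)) := by
  rcases le_total (u i) (u j) with hu | hu
  · rw [min_eq_left hu] at h1 ⊢
    exact hc.step_aux hd hij hiq hjq hu h1 h2
  · rw [min_eq_right hu] at h1 ⊢
    rw [min_comm (v i)] at h2 ⊢
    rw [hij.2.2.2]
    exact hc.step_aux hd hij.symm hjq hiq hu h1 h2

theorem MergeData.CrossInv.swap (hc : D.CrossInv a b al u v) : D.CrossInv b a al v u := by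
  intro p q hpq h1 h2
  rw [hpq.2.2.2]
  exact (hc q p hpq.symm h2 h1).symm

theorem MergeData.CrossInv.step (hc : D.CrossInv a b al u v) (hd : D.DomInv a b al u v)
    (hd' : D.DomInv b a al v u) (hij : D.Mergeable al i j) :
    D.CrossInv a b (al.erase j) (Function.update u i (min (u i) (u j)))
      (Function.update v i (min (v i) (v j))) := by
  intro p q hpq' h1 h2
  obtain ⟨hpq, hpj, hqj⟩ := mergeable_of_erase hpq'
  by_cases hp : p = i
  · subst hp
    have hqp : q ≠ p := hpq.2.2.1.symm
    simp only [Function.update_self, Function.update_of_ne hqp] at h1 h2 ⊢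
    exact hc.step_left hd hij hpq
      ⟨hij.2.1, hpq.2.1, hqj.symm, hij.2.2.2.symm.trans hpq.2.2.2⟩ h1 h2
  by_cases hq : q = i
  · subst hq
    simp only [Function.update_self, Function.update_of_ne hp] at h1 h2 ⊢
    rw [hpq.2.2.2]
    exact (hc.swap.step_left hd' hij hpq.symm
      ⟨hij.2.1, hpq.1, hpj.symm, hij.2.2.2.symm.trans hpq.2.2.2.symm⟩ h2 h1).symm
  simp only [Function.update_of_ne hp, Function.update_of_ne hq] at h1 h2 ⊢
  exact hc p q hpq h1 h2

end Step

/-- The invariants of the greedy algorithm. -/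
structure MergeInv (D : MergeData) (al : Finset ℕ) (u v : ℕ → ℝ) : Prop where
  lt : ∀ j ∈ al, j < D.m
  u_nonneg : ∀ j ∈ al, 0 ≤ u j
  v_nonneg : ∀ j ∈ al, 0 ≤ v j
  u_le : ∀ j ∈ al, u j ≤ D.u j
  v_le : ∀ j ∈ al, v j ≤ D.v j
  dom : D.DomInv D.u D.v al u v
  dom' : D.DomInv D.v D.u al v u
  cross : D.CrossInv D.u D.v al u v

theorem Reach.inv {D : MergeData} (hD : D.Valid) {al : Finset ℕ} {u v : ℕ → ℝ} {N : Network}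
    (h : Reach D al u v N) : MergeInv D al u v := by
  induction h with
  | init =>
    -- Initially the items sit at terminals and are their own witnesses.
    refine ⟨fun j hj => Finset.mem_range.1 hj, fun j hj => hD.u_nonneg j (Finset.mem_range.1 hj),
      fun j hj => hD.v_nonneg j (Finset.mem_range.1 hj), fun _ _ => le_rfl, fun _ _ => le_rfl,
      fun p q h _ h2 => ⟨q, Finset.mem_range.1 h.2.1, rfl, rfl, le_rfl, h2⟩,
      fun p q h _ h2 => ⟨q, Finset.mem_range.1 h.2.1, rfl, rfl, le_rfl, h2⟩,
      fun p q h h1 _ => Or.inl ⟨p, Finset.mem_range.1 h.1, rfl, rfl, le_rfl, h1⟩⟩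
  | @step al u v N i j _ hij hmax ih =>
    have hmax' : ∀ i' j', D.Mergeable al i' j' → gain v u i' j' ≤ gain v u i j := by
      intro i' j' h'
      have := hmax i' j' h'
      simp only [gain] at this ⊢
      linarith
    refine ⟨fun k hk => ih.lt k (Finset.mem_of_mem_erase hk), fun k hk => ?_, fun k hk => ?_,
      fun k hk => ?_, fun k hk => ?_, ih.dom.step hij hmax, ih.dom'.step hij hmax',
      ih.cross.step ih.dom ih.dom' hij⟩ <;> replace hk := Finset.mem_of_mem_erase hk <;>
      rcases eq_or_ne k i with rfl | hki
    · simp [ih.u_nonneg k hk, ih.u_nonneg j hij.2.1]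
    · simp [hki, ih.u_nonneg k hk]
    · simp [ih.v_nonneg k hk, ih.v_nonneg j hij.2.1]
    · simp [hki, ih.v_nonneg k hk]
    · simp [ih.u_le k hk]
    · simp [hki, ih.u_le k hk]
    · simp [ih.v_le k hk]
    · simp [hki, ih.v_le k hk]

/-! ### Counting active items on an antidiagonal -/

theorem exists_three_of_card {K : Finset ℕ} {u : ℕ → ℝ} (h : 2 < K.card)
    (hu : ∀ p ∈ K, ∀ q ∈ K, p ≠ q → u p ≠ u q) :
    ∃ p ∈ K, ∃ q ∈ K, ∃ r ∈ K, u p < u q ∧ u q < u r := by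
  obtain ⟨a, b, c, ha, hb, hc, hab, hac, hbc⟩ := Finset.two_lt_card_iff.1 h
  have h1 := hu a ha b hb hab
  have h2 := hu a ha c hc hac
  have h3 := hu b hb c hc hbc
  rcases lt_or_gt_of_ne h1 with h1 | h1 <;> rcases lt_or_gt_of_ne h2 with h2 | h2 <;>
    rcases lt_or_gt_of_ne h3 with h3 | h3
  exacts [⟨a, ha, b, hb, c, hc, h1, h3⟩, ⟨a, ha, c, hc, b, hb, h2, h3⟩, by linarith,
    ⟨c, hc, a, ha, b, hb, h2, h1⟩, ⟨b, hb, a, ha, c, hc, h1, h2⟩, by linarith,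
    ⟨b, hb, c, hc, a, ha, h3, h2⟩, ⟨c, hc, b, hb, a, ha, h3, h1⟩]

/-- If no two active items of the group `g` can be merged at distance `z` from the centre, then
at this distance the algorithm has at most four times as many active items as are needed to
separate the terminals of the group from the centre. -/
theorem MergeInv.card_le {D : MergeData} {al : Finset ℕ} {u v : ℕ → ℝ} (h : MergeInv D al u v)
    {g : D.Key} {z : ℝ} (hz : ∀ p q, D.Mergeable al p q → gain u v p q < z) {K : Finset ℕ}
    (hK : ∀ p ∈ K, p ∈ al ∧ D.key p = g ∧ z ≤ u p + v p) {X : Finset ℝ}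
    (hX : ∀ t < D.m, D.key t = g → z ≤ D.u t + D.v t → ∃ x ∈ X, x ≤ D.u t ∧ z - x ≤ D.v t) :
    K.card ≤ 4 * X.card := by
  rcases K.eq_empty_or_nonempty with rfl | ⟨p, hp⟩
  · simp
  have hXpos : 1 ≤ X.card := by
    obtain ⟨h1, h2, h3⟩ := hK p hp
    obtain ⟨x, hx, -⟩ := hX p (h.lt p h1) h2 (by linarith [h.u_le p h1, h.v_le p h1])
    exact Finset.card_pos.2 ⟨x, hx⟩
  have hm : ∀ p ∈ K, ∀ q ∈ K, p ≠ q → D.Mergeable al p q := fun p hp q hq hpq =>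
    ⟨(hK p hp).1, (hK q hq).1, hpq, (hK p hp).2.1.trans (hK q hq).2.1.symm⟩
  -- The items beyond distance `z` form a staircase: if one dominated another, the two could be
  -- merged at the position of the lower one, at distance at least `z`.
  have hlt : ∀ p ∈ K, ∀ q ∈ K, u p < u q → v q < v p := by
    intro p hp q hq hpq
    by_contra! hv
    have := hz p q (hm p hp q hq fun e => by simp [e] at hpq)
    rw [gain, min_eq_left hpq.le, min_eq_left hv] at this
    linarith [(hK p hp).2.2]
  have hne : ∀ p ∈ K, ∀ q ∈ K, p ≠ q → u p ≠ u q := by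
    intro p hp q hq hpq he
    have := hz p q (hm p hp q hq hpq)
    rw [gain, he, min_self] at this
    rcases min_choice (v p) (v q) with h' | h' <;> rw [h'] at this <;>
      linarith [(hK p hp).2.2, (hK q hq).2.2]
  -- Each item is labelled by the number of elements of `X` up to its first coordinate. There are at
  -- most `X.card + 1` labels, each used at most twice, and `2 * (X.card + 1) ≤ 4 * X.card` because
  -- `X` is nonempty.
  have hcard := Finset.card_le_mul_card_image (f := fun p => (X.filter (· ≤ u p)).card) K 2 ?_
  · have : (K.image fun p => (X.filter (· ≤ u p)).card) ⊆ Finset.range (X.card + 1) := by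
      intro c hc
      obtain ⟨p, -, rfl⟩ := Finset.mem_image.1 hc
      exact Finset.mem_range.2 (Nat.lt_succ_of_le (Finset.card_filter_le _ _))
    have := Finset.card_le_card this
    rw [Finset.card_range] at this
    omega
  · intro c _
    by_contra! hc
    obtain ⟨p, hp, q, hq, r, hr, hpq, hqr⟩ := exists_three_of_card hc fun p hp q hq =>
      hne p (Finset.mem_filter.1 hp).1 q (Finset.mem_filter.1 hq).1
    obtain ⟨hp, hpc⟩ := Finset.mem_filter.1 hp
    obtain ⟨hq, hqc⟩ := Finset.mem_filter.1 hq
    obtain ⟨hr, hrc⟩ := Finset.mem_filter.1 hr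
    have hvqr := hlt q hq r hr hqr
    have hmqr := hm q hq r hr fun e => by simp [e] at hqr
    -- Of three items with equal label, the outer two, `q` and `r`, have a witnessing terminal
    -- between them. It is at distance at least `z`, and so it provides an element of `X`.
    obtain ⟨x, hx, hx1, hx2⟩ : ∃ x ∈ X, x ≤ u r ∧ z - x ≤ v q := by
      rcases h.cross q r hmqr hqr hvqr with ⟨t, ht, htg, h1, h2, h3⟩ | ⟨t, ht, htg, h1, h2, h3⟩
      · obtain ⟨x, hx, h4, h5⟩ := hX t ht (htg.trans (hK q hq).2.1)
          (by linarith [(hK q hq).2.2])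
        exact ⟨x, hx, by linarith, by linarith⟩
      · obtain ⟨x, hx, h4, h5⟩ := hX t ht (htg.trans (hK q hq).2.1)
          (by linarith [(hK r hr).2.2])
        exact ⟨x, hx, by linarith, by linarith⟩
    -- Since `p` and `q` cannot be merged at `z`, `u p + v q < z`, whence `x ≥ z - v q > u p`. So
    -- `x` is counted for `r` but not for `p`, and their labels differ.
    have hg := hz p q (hm p hp q hq fun e => by simp [e] at hpq)
    rw [gain, min_eq_left hpq.le, min_eq_right (hlt p hp q hq hpq).le] at hg
    have hss : X.filter (· ≤ u p) ⊂ X.filter (· ≤ u r) := by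
      rw [Finset.ssubset_iff_of_subset]
      · exact ⟨x, by simp [hx, hx1], by simp [hx]; linarith⟩
      · exact Finset.monotone_filter_right _ fun y _ hy => le_trans hy (by linarith)
    have := Finset.card_lt_card hss
    omega

/-! ### Feasibility of the greedy network -/

section Network

variable {D : MergeData}

theorem MergeData.link_rectilinear (j : ℕ) (a b a' b' : ℝ) :
    (D.link j a b a' b').IsRectilinear := by
  intro s hs
  simp only [MergeData.link, List.mem_cons, List.not_mem_nil, or_false] at hs
  rcases hs with rfl | rfl
  · exact Or.inr rfl
  · exact Or.inl rfl

theorem MergeData.manhattan_pos (hD : D.Valid) {j : ℕ} (hj : j < D.m) (a b a' b' : ℝ) :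
    manhattan (D.pos j a b) (D.pos j a' b') = |a - a'| + |b - b'| := by
  simp only [manhattan, MergeData.pos, add_sub_add_left_eq_sub, ← mul_sub, abs_mul,
    hD.abs_sx j hj, hD.abs_sy j hj, one_mul]

theorem MergeData.link_length (hD : D.Valid) {j : ℕ} (hj : j < D.m) {a b a' b' : ℝ}
    (ha : a' ≤ a) (hb : b' ≤ b) :
    (D.link j a b a' b').length = (a + b) - (a' + b') := by
  simp only [Network.length, MergeData.link, List.map_cons, List.map_nil, List.sum_cons,
    List.sum_nil, D.manhattan_pos hD hj]
  rw [abs_of_nonneg (by linarith : 0 ≤ a - a'), abs_of_nonneg (by linarith : 0 ≤ b - b')]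
  simp; ring

theorem MergeData.joined_link (hD : D.Valid) {j : ℕ} (hj : j < D.m) {a b a' b' : ℝ} {N : Network}
    (hN : D.link j a b a' b' ⊆ N) (ha : a' ≤ a) (hb : b' ≤ b) :
    Joined N (D.pos j a b) (D.pos j a' b') ((a + b) - (a' + b')) := by
  have h1 := Joined.of_mem (N := N) (hN (by simp [MergeData.link]) :
    (D.pos j a b, D.pos j a' b) ∈ N) (Or.inr rfl)
  have h2 := Joined.of_mem (N := N) (hN (by simp [MergeData.link]) :
    (D.pos j a' b, D.pos j a' b') ∈ N) (Or.inl rfl)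
  convert h1.trans h2 using 1
  rw [D.manhattan_pos hD hj, D.manhattan_pos hD hj, abs_of_nonneg (by linarith : 0 ≤ a - a'),
    abs_of_nonneg (by linarith : 0 ≤ b - b')]
  simp; ring

theorem Network.length_append (N N' : Network) :
    Network.length (N ++ N') = N.length + N'.length := by
  unfold Network.length
  simp only [List.map_append, List.sum_append]

theorem Reach.isRectilinear {al : Finset ℕ} {u v : ℕ → ℝ} {N : Network}
    (h : Reach D al u v N) : N.IsRectilinear := by
  induction h with
  | init => intro s hs; simp at hs
  | step _ _ _ ih =>
    intro s hs
    simp only [List.mem_append] at hs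
    rcases hs with hs | hs | hs
    exacts [ih s hs, D.link_rectilinear _ _ _ _ _ s hs, D.link_rectilinear _ _ _ _ _ s hs]

/-- Every terminal stays connected with an active item of its group. -/
theorem Reach.joined (hD : D.Valid) {al : Finset ℕ} {u v : ℕ → ℝ} {N : Network}
    (h : Reach D al u v N) {t : ℕ} (ht : t < D.m) :
    ∃ k ∈ al, D.key k = D.key t ∧
      Joined N (D.pos t (D.u t) (D.v t)) (D.pos t (u k) (v k))
        ((D.u t + D.v t) - (u k + v k)) := by
  induction h with
  | init =>
    refine ⟨t, Finset.mem_range.2 ht, rfl, ?_⟩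
    rw [sub_self]; exact .refl _
  | @step al u v N i j hr hij hmax ih =>
    obtain ⟨k, hk, hkt, hj⟩ := ih
    have hI := hr.inv hD
    -- The path of `t` is prolonged by the link of its active item `k`, which lies in the quadrant
    -- of `t`.
    have aux : ∀ k, k ∈ al → D.key k = D.key t → Joined N (D.pos t (D.u t) (D.v t))
        (D.pos t (u k) (v k)) ((D.u t + D.v t) - (u k + v k)) → ∀ a b, a ≤ u k → b ≤ v k →
        ∀ M : Network, N ⊆ M → D.link k (u k) (v k) a b ⊆ M →
        Joined M (D.pos t (D.u t) (D.v t)) (D.pos t a b) ((D.u t + D.v t) - (a + b)) := by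
      intro k hk hkt hj a b ha hb M hNM hM
      have h1 := D.joined_link hD (hI.lt k hk) hM ha hb
      rw [hD.pos_congr k (hI.lt k hk) t ht hkt] at h1
      convert (hj.mono hNM).trans h1 using 1
      ring
    by_cases hki : k = i ∨ k = j
    · refine ⟨i, Finset.mem_erase.2 ⟨hij.2.2.1, hij.1⟩, ?_, ?_⟩
      · rcases hki with rfl | rfl
        exacts [hkt, hij.2.2.2.trans hkt]
      · simp only [Function.update_self]
        refine aux k hk hkt hj _ _ ?_ ?_ _ (List.subset_append_left _ _) ?_ <;>
          rcases hki with rfl | rfl <;> simp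
    · push Not at hki
      refine ⟨k, Finset.mem_erase.2 ⟨hki.2, hk⟩, hkt, ?_⟩
      simp only [Function.update_of_ne hki.1]
      exact hj.mono (List.subset_append_left _ _)

end Network

/-! ### The cost of the greedy network -/

open MeasureTheory in
/-- A pointwise comparison of the number of intervals `(0, h p]` and of sets `A i` that contain a
point gives a comparison of total lengths. -/
theorem sum_max_sub_le {α ι : Type*} (S : Finset α) (h : α → ℝ) (I : Finset ι) (A : ι → Set ℝ)
    (hA : ∀ i, MeasurableSet (A i)) {l L : ℝ} (hlL : l ≤ L) {c : ℕ}
    (H : ∀ z, l < z → z ≤ L → ∀ S' ⊆ S, (∀ p ∈ S', z ≤ h p) →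
      ∃ I' ⊆ I, (∀ i ∈ I', z ∈ A i) ∧ S'.card ≤ c * I'.card) :
    ∑ p ∈ S, (max (h p - l) 0 - max (h p - L) 0) ≤
      c * ∑ i ∈ I, volume.real (A i ∩ Set.Ioc l L) := by
  classical
  -- Layer cake: the difference is the length of the part of `(l, L]` that lies below `h p`.
  have e1 : ∀ p, max (h p - l) 0 - max (h p - L) 0 =
      ∫ z, (Set.Ioc l (min L (h p))).indicator (1 : ℝ → ℝ) z := by
    intro p
    rw [integral_indicator_one measurableSet_Ioc, Real.volume_real_Ioc]
    grind
  have e2 : ∀ i, volume.real (A i ∩ Set.Ioc l L) =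
      ∫ z, (A i ∩ Set.Ioc l L).indicator (1 : ℝ → ℝ) z := fun i =>
    (integral_indicator_one ((hA i).inter measurableSet_Ioc)).symm
  have i1 : ∀ p ∈ S, Integrable (fun z => (Set.Ioc l (min L (h p))).indicator (1 : ℝ → ℝ) z) := by
    intro p _
    exact (integrable_indicator_iff measurableSet_Ioc).2
      (integrableOn_const (by simp) (by simp))
  have i2 : ∀ i ∈ I, Integrable (fun z => (A i ∩ Set.Ioc l L).indicator (1 : ℝ → ℝ) z) := by
    intro i _
    refine (integrable_indicator_iff ((hA i).inter measurableSet_Ioc)).2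
      (integrableOn_const ?_ (by simp))
    exact ((measure_mono Set.inter_subset_right).trans_lt (by simp)).ne
  simp only [e1, e2]
  rw [← integral_finsetSum _ i1, ← integral_finsetSum _ i2, ← integral_const_mul]
  refine integral_mono (integrable_finsetSum _ i1) ((integrable_finsetSum _ i2).const_mul _) ?_
  intro z
  simp only [Set.indicator_apply, Pi.one_apply, Finset.sum_boole, Set.mem_inter_iff]
  by_cases hz : z ∈ Set.Ioc l L
  · obtain ⟨I', hI', hz', hc⟩ := H z hz.1 hz.2 (S.filter fun p => z ∈ Set.Ioc l (min L (h p)))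
      (Finset.filter_subset _ _) fun p hp => by
        have := (Finset.mem_filter.1 hp).2.2
        exact this.trans (min_le_right _ _)
    have : I' ⊆ I.filter fun i => z ∈ A i ∧ z ∈ Set.Ioc l L := fun i hi =>
      Finset.mem_filter.2 ⟨hI' hi, hz' i hi, hz⟩
    exact_mod_cast hc.trans (Nat.mul_le_mul_left _ (Finset.card_le_card this))
  · rw [Finset.filter_false_of_mem]
    · simp; positivity
    · rintro p - hp
      exact hz ⟨hp.1, hp.2.trans (min_le_left _ _)⟩

section Cost

variable {D : MergeData} {ι : Type*} {I : Finset ι} {A : ι → Set ℝ} {c : ℕ}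

/-- At every distance `z` where no merging is possible, the active items are at most `c` times
as many as the sets `A i` that contain `z`. -/
def MergeData.Covered (D : MergeData) (I : Finset ι) (A : ι → Set ℝ) (c : ℕ) : Prop :=
  ∀ z, 0 < z → ∀ al u v, MergeInv D al u v → (∀ p q, D.Mergeable al p q → gain u v p q < z) →
    ∀ K ⊆ al, (∀ p ∈ K, z ≤ u p + v p) →
      ∃ I' ⊆ I, (∀ i ∈ I', z ∈ A i) ∧ K.card ≤ c * I'.card

open MeasureTheory

/-- Between the distances `l` and `L` nothing can be merged, so the active items stay fixed there
and the covering bound can be integrated over `(l, L]`. -/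
theorem MergeData.Covered.lower (hc : D.Covered I A c) (hA : ∀ i, MeasurableSet (A i))
    (hfin : ∀ i, volume (A i) ≠ ⊤) {al : Finset ℕ} {u v : ℕ → ℝ} (hI : MergeInv D al u v)
    {x l L : ℝ} (hl : 0 ≤ l) (hlL : l ≤ L) (hg : ∀ p q, D.Mergeable al p q → gain u v p q ≤ l)
    (h : x + ∑ p ∈ al, max (u p + v p - L) 0 ≤ c * ∑ i ∈ I, volume.real (A i ∩ Set.Ioi L)) :
    x + ∑ p ∈ al, max (u p + v p - l) 0 ≤ c * ∑ i ∈ I, volume.real (A i ∩ Set.Ioi l) := by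
  have h1 := sum_max_sub_le al (fun p => u p + v p) I A hA hlL (c := c) fun z hz _ K hK hKz =>
    hc z (hl.trans_lt hz) al u v hI (fun p q hpq => (hg p q hpq).trans_lt hz) K hK hKz
  have h2 : ∀ i, volume.real (A i ∩ Set.Ioi l) =
      volume.real (A i ∩ Set.Ioc l L) + volume.real (A i ∩ Set.Ioi L) := by
    intro i
    have hd : Disjoint (A i ∩ Set.Ioc l L) (A i ∩ Set.Ioi L) :=
      Set.disjoint_left.2 fun z hz hz' => not_lt.2 hz.2.2 hz'.2
    rw [← measureReal_union hd ((hA i).inter measurableSet_Ioi)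
      (measure_ne_top_of_subset Set.inter_subset_left (hfin i))
      (measure_ne_top_of_subset Set.inter_subset_left (hfin i)),
      ← Set.inter_union_distrib_left, Set.Ioc_union_Ioi_eq_Ioi hlL]
  simp only [h2, Finset.sum_add_distrib, mul_add]
  rw [Finset.sum_sub_distrib] at h1
  linarith

theorem gain_mono {u v u' v' : ℕ → ℝ} (hu : u' ≤ u) (hv : v' ≤ v) (i j : ℕ) :
    gain u' v' i j ≤ gain u v i j :=
  add_le_add (min_le_min (hu i) (hu j)) (min_le_min (hv i) (hv j))

/-- `L` is the distance to which the sweep has come. The network together with the parts of the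
active items beyond `L` is paid for by the sets beyond `L`. Before a merge the sweep is lowered to
the gain of the pair; the merge itself only turns the parts of `i` and `j` beyond `L` into links. -/
theorem Reach.cost (hD : D.Valid) (hc : D.Covered I A c) (hA : ∀ i, MeasurableSet (A i))
    (hfin : ∀ i, volume (A i) ≠ ⊤) {al : Finset ℕ} {u v : ℕ → ℝ} {N : Network}
    (h : Reach D al u v N) :
    ∃ L, 0 ≤ L ∧ (∀ p q, D.Mergeable al p q → gain u v p q ≤ L) ∧
      N.length + ∑ p ∈ al, max (u p + v p - L) 0 ≤
        c * ∑ i ∈ I, volume.real (A i ∩ Set.Ioi L) := by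
  induction h with
  | init =>
    have hle : ∀ j ∈ Finset.range D.m, D.u j + D.v j ≤ ∑ j ∈ Finset.range D.m, (D.u j + D.v j) :=
      fun j hj => Finset.single_le_sum (f := fun j => D.u j + D.v j) (fun i hi =>
        add_nonneg (hD.u_nonneg i (Finset.mem_range.1 hi)) (hD.v_nonneg i (Finset.mem_range.1 hi)))
        hj
    -- The sweep may start at any bound for all distances.
    refine ⟨∑ j ∈ Finset.range D.m, (D.u j + D.v j), Finset.sum_nonneg fun i hi =>
        add_nonneg (hD.u_nonneg i (Finset.mem_range.1 hi)) (hD.v_nonneg i (Finset.mem_range.1 hi)),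
        fun p q hpq => ?_, ?_⟩
    · exact (add_le_add (min_le_left _ _) (min_le_left _ _)).trans (hle p hpq.1)
    · rw [Finset.sum_eq_zero fun p hp => max_eq_right (by linarith [hle p hp])]
      simp only [Network.length, List.map_nil, List.sum_nil, add_zero]
      positivity
  | @step al u v N i j hr hij hmax ih =>
    obtain ⟨L, hL, hg, hle⟩ := ih
    have hI := hr.inv hD
    have h0 : 0 ≤ gain u v i j := add_nonneg
      (le_min (hI.u_nonneg i hij.1) (hI.u_nonneg j hij.2.1))
      (le_min (hI.v_nonneg i hij.1) (hI.v_nonneg j hij.2.1))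
    have hlow := hc.lower hA hfin hI h0 (hg i j hij) hmax hle
    refine ⟨gain u v i j, h0, fun p q hpq => ?_, hlow.trans' ?_⟩
    · refine (gain_mono ?_ ?_ p q).trans (hmax p q (mergeable_of_erase hpq).1) <;> intro k <;>
        rcases eq_or_ne k i with rfl | hk <;> simp [*]
    · have hi : i ∈ al.erase j := Finset.mem_erase.2 ⟨hij.2.2.1, hij.1⟩
      rw [← Finset.add_sum_erase al _ hij.2.1, ← Finset.add_sum_erase _ _ hi,
        ← Finset.add_sum_erase (al.erase j) _ hi]
      simp only [Function.update_self]
      have hrest : ∑ p ∈ (al.erase j).erase i,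
          max (Function.update u i (min (u i) (u j)) p + Function.update v i (min (v i) (v j)) p -
            gain u v i j) 0 = ∑ p ∈ (al.erase j).erase i, max (u p + v p - gain u v i j) 0 := by
        refine Finset.sum_congr rfl fun p hp => ?_
        have := Finset.ne_of_mem_erase hp
        simp [this]
      rw [hrest, Network.length_append, Network.length_append,
        D.link_length hD (hI.lt i hij.1) (min_le_left _ _) (min_le_left _ _),
        D.link_length hD (hI.lt j hij.2.1) (min_le_right _ _) (min_le_right _ _)]
      -- The merged item lies exactly at the new threshold and contributes nothing beyond it.
      have e : max (min (u i) (u j) + min (v i) (v j) - gain u v i j) 0 = 0 := by simp [gain]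
      have l1 := le_max_left (u i + v i - gain u v i j) 0
      have l2 := le_max_left (u j + v j - gain u v i j) 0
      rw [e]
      simp only [gain] at l1 l2 ⊢
      linarith

/-- The cost of the greedy network, when no more merging is possible and the remaining items get
connected with their centres. -/
theorem Reach.cost_final (hD : D.Valid) (hc : D.Covered I A c) (hA : ∀ i, MeasurableSet (A i))
    (hfin : ∀ i, volume (A i) ≠ ⊤) {al : Finset ℕ} {u v : ℕ → ℝ} {N : Network}
    (h : Reach D al u v N) (hno : ∀ p q, ¬ D.Mergeable al p q) :
    N.length + ∑ p ∈ al, (u p + v p) ≤ c * ∑ i ∈ I, volume.real (A i) := by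
  obtain ⟨L, hL, -, hle⟩ := h.cost hD hc hA hfin
  have hI := h.inv hD
  -- With no merge left the sweep can go down to distance 0, and the remaining distances are the
  -- final connections to the centres.
  have := hc.lower hA hfin hI le_rfl hL (fun p q hpq => absurd hpq (hno p q)) hle
  rw [Finset.sum_congr rfl fun p hp => show max (u p + v p - 0) 0 = u p + v p by
    rw [sub_zero]; exact max_eq_left (add_nonneg (hI.u_nonneg p hp) (hI.v_nonneg p hp))] at this
  refine this.trans ?_
  gcongr with i hi
  · exact hfin i
  · exact Set.inter_subset_left

end Cost

/-! ### Dyadic decomposition of the terminal pairs -/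

/-- The number of the points `P 0, …, P (m - 1)` to the left of `x`. -/
noncomputable def rank (m : ℕ) (P : ℕ → ℝ) (x : ℝ) : ℕ := {i ∈ Finset.range m | P i < x}.card

theorem rank_mono (m : ℕ) (P : ℕ → ℝ) : Monotone (rank m P) := fun _ _ h =>
  Finset.card_le_card (Finset.monotone_filter_right _ fun _ _ hi => lt_of_lt_of_le hi h)

theorem rank_le (m : ℕ) (P : ℕ → ℝ) (x : ℝ) : rank m P x ≤ m :=
  (Finset.card_filter_le _ _).trans_eq (Finset.card_range m)

theorem rank_lt_rank {m : ℕ} {P : ℕ → ℝ} {i : ℕ} (hi : i < m) {x : ℝ} (h : P i < x) :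
    rank m P (P i) < rank m P x := by
  refine Finset.card_lt_card ((Finset.ssubset_iff_of_subset ?_).2 ⟨i, ?_, ?_⟩)
  · exact Finset.monotone_filter_right _ fun _ _ hi => lt_trans hi h
  · simp [hi, h]
  · simp

/-- One coordinate of the pairs of terminals `(P j, Q j)`: the pair `j` is assigned to the node
`(lev j, anc j)` of a binary tree over the ranks, and `C j` is the coordinate at which the pairs of
this node get separated. -/
structure Axis where
  P : ℕ → ℝ
  Q : ℕ → ℝ
  lev : ℕ → ℕ
  anc : ℕ → ℕ
  C : ℕ → ℝ

namespace Axis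

/-- Minimality of the level makes the node the lowest common ancestor of the two ranks. The last two
fields make `C` the largest left end at the node. The first field holds because both orders of each
pair are items; it ensures that ranks also distinguish partner coordinates. -/
structure Valid (A : Axis) (m : ℕ) : Prop where
  exists_P : ∀ j < m, ∃ i < m, A.P i = A.Q j
  anc_P : ∀ j < m, rank m A.P (A.P j) / 2 ^ A.lev j = A.anc j
  anc_Q : ∀ j < m, rank m A.P (A.Q j) / 2 ^ A.lev j = A.anc j
  lev_min : ∀ j < m, ∀ l < A.lev j, rank m A.P (A.P j) / 2 ^ l ≠ rank m A.P (A.Q j) / 2 ^ l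
  le_C : ∀ i < m, ∀ j < m, A.lev i = A.lev j → A.anc i = A.anc j → min (A.P i) (A.Q i) ≤ A.C j
  C_eq : ∀ j < m, ∃ i < m, A.lev i = A.lev j ∧ A.anc i = A.anc j ∧ A.C j = min (A.P i) (A.Q i)

variable {A : Axis} {m : ℕ}

theorem Valid.C_congr (h : A.Valid m) {i j : ℕ} (hi : i < m) (hj : j < m)
    (hl : A.lev i = A.lev j) (ha : A.anc i = A.anc j) : A.C i = A.C j := by
  apply le_antisymm
  · obtain ⟨k, hk, h1, h2, h3⟩ := h.C_eq i hi
    exact h3 ▸ h.le_C k hk j hj (h1.trans hl) (h2.trans ha)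
  · obtain ⟨k, hk, h1, h2, h3⟩ := h.C_eq j hj
    exact h3 ▸ h.le_C k hk i hi (h1.trans hl.symm) (h2.trans ha.symm)

/-- Suppose the interval of `i` lies strictly to the right of that of `j`. The terminals of `j`
occupy both children of the node, so the larger one is in the right child. Then both terminals of
`i` are in the right child as well, against the minimality of the level. At level 0 all four ranks
coincide. -/
theorem Valid.min_le_max (h : A.Valid m) {i j : ℕ} (hi : i < m) (hj : j < m)
    (hl : A.lev i = A.lev j) (ha : A.anc i = A.anc j) :
    min (A.P i) (A.Q i) ≤ max (A.P j) (A.Q j) := by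
  by_contra! hlt
  obtain ⟨k, hk, hkj⟩ : ∃ k < m, A.P k = max (A.P j) (A.Q j) := by
    rcases max_choice (A.P j) (A.Q j) with e | e <;> rw [e]
    exacts [⟨j, hj, rfl⟩, h.exists_P j hj]
  have hr := rank_lt_rank (P := A.P) hk (hkj ▸ hlt)
  rw [hkj, (rank_mono m A.P).map_max, (rank_mono m A.P).map_min] at hr
  have h1 := h.anc_P i hi
  have h2 := h.anc_Q i hi
  have h3 := h.anc_P j hj
  have h4 := h.anc_Q j hj
  have h5 := h.lev_min i hi
  have h6 := h.lev_min j hj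
  rw [hl] at h1 h2 h5
  rw [ha] at h1 h2
  cases hlev : A.lev j with
  | zero => simp only [hlev, pow_zero, Nat.div_one] at *; omega
  | succ l =>
    rw [hlev] at h1 h2 h3 h4 h5 h6
    have g1 := h5 l (Nat.lt_succ_self l)
    have g2 := h6 l (Nat.lt_succ_self l)
    rw [pow_succ, ← Nat.div_div_eq_div_mul] at h1 h2 h3 h4
    have q1 := Nat.div_le_div_right (c := 2 ^ l) (max_lt_iff.1 (lt_min_iff.1 hr).1).1.le
    have q2 := Nat.div_le_div_right (c := 2 ^ l) (max_lt_iff.1 (lt_min_iff.1 hr).1).2.le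
    have q3 := Nat.div_le_div_right (c := 2 ^ l) (max_lt_iff.1 (lt_min_iff.1 hr).2).1.le
    have q4 := Nat.div_le_div_right (c := 2 ^ l) (max_lt_iff.1 (lt_min_iff.1 hr).2).2.le
    omega

theorem Valid.min_le_C (h : A.Valid m) {j : ℕ} (hj : j < m) : min (A.P j) (A.Q j) ≤ A.C j :=
  h.le_C j hj j hj rfl rfl

theorem Valid.C_le_max (h : A.Valid m) {j : ℕ} (hj : j < m) : A.C j ≤ max (A.P j) (A.Q j) := by
  obtain ⟨i, hi, h1, h2, h3⟩ := h.C_eq j hj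
  exact h3 ▸ h.min_le_max hi hj h1 h2

/-- Ranks are at most `m`, so after `Nat.log 2 m + 1` halvings all of them are 0. -/
theorem Valid.lev_lt (h : A.Valid m) {j : ℕ} (hj : j < m) : A.lev j < Nat.log 2 m + 2 := by
  by_contra! hl
  refine h.lev_min j hj (Nat.log 2 m + 1) (by omega) ?_
  have := Nat.lt_pow_succ_log_self (b := 2) (by norm_num) m
  rw [Nat.div_eq_of_lt ((rank_le m A.P _).trans_lt this),
    Nat.div_eq_of_lt ((rank_le m A.P _).trans_lt this)]

theorem Valid.anc_lt (h : A.Valid m) {j : ℕ} (hj : j < m) : A.anc j < m + 1 := by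
  rw [← h.anc_P j hj]
  exact Nat.lt_succ_of_le ((Nat.div_le_self _ _).trans (rank_le _ _ _))

/-- The node of the pair `j` and the order of its terminals. -/
noncomputable def key (A : Axis) (j : ℕ) : ℕ × ℕ × Bool :=
  open Classical in (A.lev j, A.anc j, decide (A.P j ≤ A.Q j))

/-- The direction from the centre to the first terminals of a group. -/
def sign (b : Bool) : ℝ := if b then -1 else 1

theorem abs_sign (b : Bool) : |sign b| = 1 := by cases b <;> simp [sign]

/-- Together with `sign_mul_Q`: the centre separates the two terminals, and the orientation tells on
which side the first one lies. -/
theorem Valid.sign_mul_P (h : A.Valid m) {j : ℕ} (hj : j < m) :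
    sign (A.key j).2.2 * (A.P j - A.C j) = |A.P j - A.C j| := by
  have h1 := h.min_le_C hj
  have h2 := h.C_le_max hj
  by_cases hb : A.P j ≤ A.Q j
  · rw [min_eq_left hb] at h1
    rw [abs_of_nonpos (by linarith)]
    simp [key, hb, sign]
  · rw [max_eq_left (not_le.1 hb).le] at h2
    rw [abs_of_nonneg (by linarith)]
    simp [key, hb, sign]

theorem Valid.sign_mul_Q (h : A.Valid m) {j : ℕ} (hj : j < m) :
    sign (A.key j).2.2 * (A.Q j - A.C j) ≤ 0 := by
  have h1 := h.min_le_C hj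
  have h2 := h.C_le_max hj
  by_cases hb : A.P j ≤ A.Q j
  · rw [max_eq_right hb] at h2
    simpa [key, hb, sign] using h2
  · rw [min_eq_right (not_le.1 hb).le] at h1
    simpa [key, hb, sign] using h1

/-- Ranks are monotone, so everything between the two terminals belongs to their node. This confines
M-paths to the box of their group. -/
theorem Valid.rank_div_eq (h : A.Valid m) {j : ℕ} (hj : j < m) {x : ℝ}
    (hx : x ∈ Set.uIcc (A.P j) (A.Q j)) : rank m A.P x / 2 ^ A.lev j = A.anc j := by
  have hm := rank_mono m A.P
  have h1 := h.anc_P j hj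
  have h2 := h.anc_Q j hj
  rcases Set.mem_uIcc.1 hx with hx | hx
  · have q1 := Nat.div_le_div_right (c := 2 ^ A.lev j) (hm hx.1)
    have q2 := Nat.div_le_div_right (c := 2 ^ A.lev j) (hm hx.2)
    omega
  · have q1 := Nat.div_le_div_right (c := 2 ^ A.lev j) (hm hx.1)
    have q2 := Nat.div_le_div_right (c := 2 ^ A.lev j) (hm hx.2)
    omega

end Axis

/-- The groups of terminals: a node of the tree and an orientation for each coordinate. -/
abbrev PairKey : Type := (ℕ × ℕ × Bool) × (ℕ × ℕ × Bool)

/-- The merging problem for two coordinates. -/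
noncomputable def mergeData (m : ℕ) (X Y : Axis) : MergeData where
  m := m
  Key := PairKey
  key j := (X.key j, Y.key j)
  u j := |X.P j - X.C j|
  v j := |Y.P j - Y.C j|
  cx := X.C
  cy := Y.C
  sx j := Axis.sign (X.key j).2.2
  sy j := Axis.sign (Y.key j).2.2

section

variable {m : ℕ} {X Y : Axis}

theorem mergeData_valid (hX : X.Valid m) (hY : Y.Valid m) : (mergeData m X Y).Valid where
  u_nonneg _ _ := abs_nonneg _
  v_nonneg _ _ := abs_nonneg _
  abs_sx _ _ := Axis.abs_sign _
  abs_sy _ _ := Axis.abs_sign _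
  pos_congr i hi j hj h := by
    have h' : (X.key i, Y.key i) = (X.key j, Y.key j) := h
    obtain ⟨h1, h2⟩ := Prod.ext_iff.1 h'
    dsimp only at h1 h2
    have e1 := hX.C_congr hi hj (congrArg Prod.fst h1) (congrArg (fun k => k.2.1) h1)
    have e2 := hY.C_congr hi hj (congrArg Prod.fst h2) (congrArg (fun k => k.2.1) h2)
    funext a b
    simp only [MergeData.pos, mergeData, h1, h2, e1, e2]

theorem mergeData_pos_start (hX : X.Valid m) (hY : Y.Valid m) {j : ℕ} (hj : j < m) :
    (mergeData m X Y).pos j ((mergeData m X Y).u j) ((mergeData m X Y).v j) =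
      (X.P j, Y.P j) := by
  have h1 := hX.sign_mul_P hj
  have h2 := hY.sign_mul_P hj
  have aux : ∀ b (x : ℝ), Axis.sign b * (Axis.sign b * x) = x := by
    intro b x; cases b <;> simp [Axis.sign]
  simp only [MergeData.pos, mergeData, ← h1, ← h2, aux]
  simp

theorem mergeData_pos_zero (j : ℕ) : (mergeData m X Y).pos j 0 0 = (X.C j, Y.C j) := by
  simp [MergeData.pos, mergeData]

/-! ### The lower bound -/

/-- The points that belong to the node of the group `g` in both coordinates. -/
def box (m : ℕ) (X Y : Axis) (g : PairKey) : Set Pt :=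
  {w | rank m X.P w.1 / 2 ^ g.1.1 = g.1.2.1 ∧ rank m Y.P w.2 / 2 ^ g.2.1 = g.2.2.1}

/-- The parameters of the points of a segment that lie in `B`. -/
def paramSet (s : Pt × Pt) (B : Set Pt) : Set ℝ :=
  {θ | θ ∈ Set.Icc (0 : ℝ) 1 ∧ AffineMap.lineMap s.1 s.2 θ ∈ B}

open MeasureTheory

theorem measurableSet_box (g : PairKey) : MeasurableSet (box m X Y g) := by
  have h1 : Measurable fun w : Pt => rank m X.P w.1 / 2 ^ g.1.1 :=
    (Measurable.of_discrete (f := fun k : ℕ => k / 2 ^ g.1.1)).comp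
      ((rank_mono m X.P).measurable.comp measurable_fst)
  have h2 : Measurable fun w : Pt => rank m Y.P w.2 / 2 ^ g.2.1 :=
    (Measurable.of_discrete (f := fun k : ℕ => k / 2 ^ g.2.1)).comp
      ((rank_mono m Y.P).measurable.comp measurable_snd)
  exact (h1 (measurableSet_singleton _)).inter (h2 (measurableSet_singleton _))

theorem measurableSet_paramSet (s : Pt × Pt) {B : Set Pt} (hB : MeasurableSet B) :
    MeasurableSet (paramSet s B) :=
  measurableSet_Icc.inter (AffineMap.lineMap_continuous.measurable hB)

theorem volume_paramSet_ne_top (s : Pt × Pt) (B : Set Pt) : volume (paramSet s B) ≠ ⊤ :=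
  ((measure_mono fun _ h => h.1 : volume (paramSet s B) ≤ volume (Set.Icc (0 : ℝ) 1)).trans_lt
    (by simp)).ne

/-- The values that a function takes on the part of a segment in `B` have small measure. -/
theorem volume_image_le {h : Pt → ℝ} (hh : ∀ p q, |h p - h q| ≤ manhattan p q) (s : Pt × Pt)
    (B B' : Set Pt) (hB : B' ⊆ B) :
    volume (h '' (segment ℝ s.1 s.2 ∩ B')) ≤
      ENNReal.ofReal (manhattan s.1 s.2) * volume (paramSet s B) := by
  have hsub : h '' (segment ℝ s.1 s.2 ∩ B') ⊆
      (fun θ => h (AffineMap.lineMap s.1 s.2 θ)) '' paramSet s B := by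
    rintro _ ⟨w, ⟨hw, hwB⟩, rfl⟩
    rw [segment_eq_image_lineMap] at hw
    obtain ⟨θ, hθ, rfl⟩ := hw
    exact ⟨θ, ⟨hθ, hB hwB⟩, rfl⟩
  have hlip : LipschitzOnWith (manhattan s.1 s.2).toNNReal
      (fun θ => h (AffineMap.lineMap s.1 s.2 θ)) (paramSet s B) := by
    refine LipschitzOnWith.of_dist_le_mul fun a _ b _ => ?_
    rw [Real.dist_eq, Real.dist_eq, Real.coe_toNNReal _ (manhattan_nonneg _ _)]
    refine (hh _ _).trans_eq ?_
    simp only [manhattan, AffineMap.lineMap_apply_module', Prod.fst_add, Prod.snd_add,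
      Prod.smul_fst, Prod.smul_snd, Prod.fst_sub, Prod.snd_sub, smul_eq_mul,
      add_sub_add_right_eq_sub, ← sub_mul, abs_mul]
    rw [abs_sub_comm s.2.1, abs_sub_comm s.2.2]
    ring
  -- On the line, one-dimensional Hausdorff measure is Lebesgue measure, and a Lipschitz map
  -- enlarges it at most by its constant.
  have := hlip.hausdorffMeasure_image_le (d := 1) zero_le_one
  rw [hausdorffMeasure_real, ENNReal.rpow_one] at this
  exact (measure_mono hsub).trans this

/-- For fixed levels and orientations the boxes of different nodes are disjoint, so their parameter
sets have total measure at most 1. There are `(2 * K) ^ 2` choices of levels and orientations. -/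
theorem sum_paramSet_le (s : Pt × Pt) (K : ℕ) :
    ∑ g ∈ (Finset.range K ×ˢ Finset.range (m + 1) ×ˢ (Finset.univ : Finset Bool)) ×ˢ
      (Finset.range K ×ˢ Finset.range (m + 1) ×ˢ (Finset.univ : Finset Bool)),
        volume.real (paramSet s (box m X Y g)) ≤ 4 * K ^ 2 := by
  have key : ∀ lx ly : ℕ, ∀ bx bY : Bool,
      ∑ a ∈ Finset.range (m + 1) ×ˢ Finset.range (m + 1),
        volume.real (paramSet s (box m X Y ((lx, a.1, bx), (ly, a.2, bY)))) ≤ 1 := by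
    intro lx ly bx bY
    rw [← measureReal_biUnion_finset (h := fun a _ => volume_paramSet_ne_top _ _)]
    · refine (measureReal_mono (s₂ := Set.Icc (0 : ℝ) 1) ?_ (by simp)).trans (by simp)
      intro θ hθ
      simp only [Set.mem_iUnion] at hθ
      obtain ⟨_, _, h⟩ := hθ
      exact h.1
    · intro a _ b _ hab
      refine Set.disjoint_left.2 fun θ h1 h2 => hab ?_
      exact Prod.ext (h1.2.1.symm.trans h2.2.1) (h1.2.2.symm.trans h2.2.2)
    · exact fun a _ => measurableSet_paramSet s (measurableSet_box _)
  have e : ∑ g ∈ (Finset.range K ×ˢ Finset.range (m + 1) ×ˢ (Finset.univ : Finset Bool)) ×ˢ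
      (Finset.range K ×ˢ Finset.range (m + 1) ×ˢ (Finset.univ : Finset Bool)),
        volume.real (paramSet s (box m X Y g)) =
      ∑ k ∈ (Finset.range K ×ˢ (Finset.univ : Finset Bool)) ×ˢ
        (Finset.range K ×ˢ (Finset.univ : Finset Bool)),
        ∑ a ∈ Finset.range (m + 1) ×ˢ Finset.range (m + 1),
          volume.real (paramSet s (box m X Y ((k.1.1, a.1, k.1.2), (k.2.1, a.2, k.2.2)))) := by
    rw [← Finset.sum_product']
    refine Finset.sum_bij' (fun g _ => (((g.1.1, g.1.2.2), (g.2.1, g.2.2.2)), (g.1.2.1, g.2.2.1)))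
      (fun k _ => ((k.1.1.1, k.2.1, k.1.1.2), (k.1.2.1, k.2.2, k.1.2.2))) ?_ ?_ ?_ ?_ ?_
    · intro g hg; simp only [Finset.mem_product, Finset.mem_univ, and_true] at hg ⊢; tauto
    · intro g hg; simp only [Finset.mem_product, Finset.mem_univ, and_true] at hg ⊢; tauto
    · intros; rfl
    · intros; rfl
    · intros; rfl
  rw [e]
  refine (Finset.sum_le_sum fun k _ => key k.1.1 k.2.1 k.1.2 k.2.2).trans_eq ?_
  simp
  ring

end

/-- Within the bounding box of `p` and `q`, every continuous function attains on the network all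
values between its values at `p` and `q` (unless these coincide). -/
def Crosses (N : Network) (p q : Pt) : Prop :=
  ∀ f : Pt → ℝ, Continuous f → ∀ z ∈ Set.uIcc (f p) (f q), f p ≠ f q →
    ∃ w ∈ N.carrier, f w = z ∧ w.1 ∈ Set.uIcc p.1 q.1 ∧ w.2 ∈ Set.uIcc p.2 q.2

theorem MConnected.crosses {N : Network} {p q : Pt} (h : MConnected N p q) : Crosses N p q :=
  fun _ hf _ hz hne => h.exists_eq hf hz hne

/-- Reversed pairs are items too; working with crossings instead of paths makes the symmetry
immediate. -/
theorem Crosses.symm {N : Network} {p q : Pt} (h : Crosses N p q) : Crosses N q p := by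
  intro f hf z hz hne
  rw [Set.uIcc_comm] at hz
  obtain ⟨w, h1, h2, h3, h4⟩ := h f hf z hz hne.symm
  exact ⟨w, h1, h2, by rwa [Set.uIcc_comm], by rwa [Set.uIcc_comm]⟩

/-- The first coordinate of `w` in the quadrant of the group `g` with centre `c`. -/
def quadX (c : Pt) (g : PairKey) (w : Pt) : ℝ := Axis.sign g.1.2.2 * (w.1 - c.1)

/-- The second coordinate of `w` in the quadrant of the group `g` with centre `c`. -/
def quadY (c : Pt) (g : PairKey) (w : Pt) : ℝ := Axis.sign g.2.2.2 * (w.2 - c.2)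

theorem abs_quadX_sub (c : Pt) (g : PairKey) (p q : Pt) :
    |quadX c g p - quadX c g q| = |p.1 - q.1| := by
  rw [quadX, quadX, ← mul_sub, abs_mul, Axis.abs_sign]; simp

theorem abs_quadY_sub (c : Pt) (g : PairKey) (p q : Pt) :
    |quadY c g p - quadY c g q| = |p.2 - q.2| := by
  rw [quadY, quadY, ← mul_sub, abs_mul, Axis.abs_sign]; simp

/-- One coordinate is constant along the segment, so the sum determines the other. Thus a segment
meets each antidiagonal of the group in at most one first coordinate. -/
theorem quadX_eq_of_add_eq {c : Pt} {g : PairKey} {s : Pt × Pt} (hs : AxisParallel s.1 s.2)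
    {w w' : Pt} (hw : w ∈ segment ℝ s.1 s.2) (hw' : w' ∈ segment ℝ s.1 s.2)
    (h : quadX c g w + quadY c g w = quadX c g w' + quadY c g w') :
    quadX c g w = quadX c g w' := by
  obtain ⟨a, b, ha, hb, hab, rfl⟩ := hw
  obtain ⟨a', b', ha', hb', hab', rfl⟩ := hw'
  rcases hs with hs | hs
  · simp only [quadX, Prod.fst_add, Prod.smul_fst, smul_eq_mul, hs, ← add_mul, hab, hab']
  · have : quadY c g (a • s.1 + b • s.2) = quadY c g (a' • s.1 + b' • s.2) := by
      simp only [quadY, Prod.snd_add, Prod.smul_snd, smul_eq_mul, hs, ← add_mul, hab, hab']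
    linarith

section

variable {m : ℕ} {X Y : Axis}

/-- The distances from the centre at which a network segment meets the box of a group within
its quadrant (`k = 0`), and the coordinates of the points of the segment in the
box (`k = 1`, `k = 2`). -/
def crossSet (m : ℕ) (X Y : Axis) (c : PairKey → Pt) (s : Pt × Pt) (g : PairKey) :
    Fin 3 → Set ℝ
  | 0 => (fun w => quadX (c g) g w + quadY (c g) g w) '' (segment ℝ s.1 s.2 ∩
      {w | w ∈ box m X Y g ∧ 0 ≤ quadX (c g) g w ∧ 0 ≤ quadY (c g) g w})
  | 1 => quadX (c g) g '' (segment ℝ s.1 s.2 ∩ box m X Y g)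
  | 2 => quadY (c g) g '' (segment ℝ s.1 s.2 ∩ box m X Y g)

open MeasureTheory

theorem volume_crossSet_le (c : PairKey → Pt) (s : Pt × Pt) (g : PairKey) (k : Fin 3) :
    volume (crossSet m X Y c s g k) ≤
      ENNReal.ofReal (manhattan s.1 s.2) * volume (paramSet s (box m X Y g)) := by
  match k with
  | 0 =>
    refine volume_image_le (fun p q => ?_) s _ _ fun w hw => hw.1
    rw [add_sub_add_comm]
    refine (abs_add_le _ _).trans_eq ?_
    rw [abs_quadX_sub, abs_quadY_sub, manhattan]
  | 1 =>
    refine volume_image_le (fun p q => ?_) s _ _ subset_rfl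
    rw [abs_quadX_sub, manhattan]; linarith [abs_nonneg (p.2 - q.2)]
  | 2 =>
    refine volume_image_le (fun p q => ?_) s _ _ subset_rfl
    rw [abs_quadY_sub, manhattan]; linarith [abs_nonneg (p.1 - q.1)]

theorem exists_centre (hX : X.Valid m) (hY : Y.Valid m) :
    ∃ c : PairKey → Pt, ∀ j < m, c (X.key j, Y.key j) = (X.C j, Y.C j) := by
  classical
  refine ⟨fun g => if h : ∃ j < m, (X.key j, Y.key j) = g then (X.C h.choose, Y.C h.choose)
    else 0, fun j hj => ?_⟩
  have h : ∃ i < m, (X.key i, Y.key i) = (X.key j, Y.key j) := ⟨j, hj, rfl⟩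
  beta_reduce
  rw [dif_pos h]
  have := (mergeData_valid hX hY).pos_congr _ h.choose_spec.1 j hj h.choose_spec.2
  have h0 := congrFun (congrFun this 0) 0
  rwa [mergeData_pos_zero, mergeData_pos_zero] at h0

/-- The groups that may occur. -/
def keys (m K : ℕ) : Finset PairKey :=
  (Finset.range K ×ˢ Finset.range (m + 1) ×ˢ Finset.univ) ×ˢ
    (Finset.range K ×ˢ Finset.range (m + 1) ×ˢ Finset.univ)

theorem key_mem_keys (hX : X.Valid m) (hY : Y.Valid m) {j : ℕ} (hj : j < m) :
    (X.key j, Y.key j) ∈ keys m (Nat.log 2 m + 2) := by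
  simp only [keys, Axis.key, Finset.mem_product, Finset.mem_range, Finset.mem_univ, and_true]
  exact ⟨⟨hX.lev_lt hj, hX.anc_lt hj⟩, hY.lev_lt hj, hY.anc_lt hj⟩

/-- For the terminals of the group `g` at distance at least `z` from the centre, the network
contains a point on the way to the centre at distance `z`, or it crosses a coordinate line at
distance `z` from the axis. -/
theorem exists_crossing (hX : X.Valid m) (hY : Y.Valid m) {c : PairKey → Pt}
    (hc : ∀ j < m, c (X.key j, Y.key j) = (X.C j, Y.C j)) {N : Network} {t : ℕ} (ht : t < m)
    (hN : Crosses N (X.P t, Y.P t) (X.Q t, Y.Q t)) {z : ℝ} (hz : 0 < z)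
    (hzt : z ≤ |X.P t - X.C t| + |Y.P t - Y.C t|) :
    ∃ s ∈ N, ∃ w ∈ segment ℝ s.1 s.2, w ∈ box m X Y (X.key t, Y.key t) ∧
      max (quadX (c (X.key t, Y.key t)) (X.key t, Y.key t) w) 0 +
        max (quadY (c (X.key t, Y.key t)) (X.key t, Y.key t) w) 0 = z ∧
      quadX (c (X.key t, Y.key t)) (X.key t, Y.key t) w ≤ |X.P t - X.C t| ∧
      quadY (c (X.key t, Y.key t)) (X.key t, Y.key t) w ≤ |Y.P t - Y.C t| := by
  set g : PairKey := (X.key t, Y.key t) with hg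
  have hqX : ∀ w : Pt, quadX (c g) g w = Axis.sign (X.key t).2.2 * (w.1 - X.C t) := by
    intro w; rw [quadX, hc t ht]
  have hqY : ∀ w : Pt, quadY (c g) g w = Axis.sign (Y.key t).2.2 * (w.2 - Y.C t) := by
    intro w; rw [quadY, hc t ht]
  have pX := hX.sign_mul_P ht
  have pY := hY.sign_mul_P ht
  have qX := hX.sign_mul_Q ht
  have qY := hY.sign_mul_Q ht
  have fp : max (quadX (c g) g (X.P t, Y.P t)) 0 + max (quadY (c g) g (X.P t, Y.P t)) 0 =
      |X.P t - X.C t| + |Y.P t - Y.C t| := by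
    rw [hqX, hqY, pX, pY, max_eq_left (abs_nonneg _), max_eq_left (abs_nonneg _)]
  have fq : max (quadX (c g) g (X.Q t, Y.Q t)) 0 + max (quadY (c g) g (X.Q t, Y.Q t)) 0 = 0 := by
    rw [hqX, hqY, max_eq_right qX, max_eq_right qY, add_zero]
  -- The clipped distance falls from the distance of the terminal to 0 at its partner. Clipping is
  -- needed because an M-path may bypass the quadrant's corner, the centre, on either side.
  obtain ⟨w, hw, hwz, hw1, hw2⟩ := hN
    (fun w => max (quadX (c g) g w) 0 + max (quadY (c g) g w) 0)
    (by unfold quadX quadY; fun_prop) z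
    (by rw [fp, fq, Set.mem_uIcc]; right; exact ⟨hz.le, hzt⟩) (by rw [fp, fq]; linarith)
  simp only [Network.carrier, Set.mem_iUnion] at hw
  obtain ⟨s, hs, hws⟩ := hw
  have bound : ∀ (b : Bool) (p q x C : ℝ), x ∈ Set.uIcc p q →
      Axis.sign b * (p - C) = |p - C| → Axis.sign b * (q - C) ≤ 0 →
      Axis.sign b * (x - C) ≤ |p - C| := by
    intro b p q x C hx h1 h2
    have := abs_nonneg (p - C)
    rw [Set.mem_uIcc] at hx
    cases b <;> simp only [Axis.sign, Bool.false_eq_true, if_true, if_false] at h1 h2 ⊢ <;>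
      rcases hx with hx | hx <;> linarith
  refine ⟨s, hs, w, hws, ⟨hX.rank_div_eq ht hw1, hY.rank_div_eq ht hw2⟩, hwz, ?_, ?_⟩
  · rw [hqX]; exact bound _ _ _ _ _ hw1 pX qX
  · rw [hqY]; exact bound _ _ _ _ _ hw2 pY qY

/-- Every crossing is encoded by a segment, a group and a kind, and yields a single abscissa for
`MergeInv.card_le`. The crossing sets are replaced by measurable hulls, which have the same measure.
-/
theorem mergeData_covered (hX : X.Valid m) (hY : Y.Valid m) {c : PairKey → Pt}
    (hc : ∀ j < m, c (X.key j, Y.key j) = (X.C j, Y.C j)) {N : Network} (hr : N.IsRectilinear)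
    (hN : ∀ j < m, Crosses N (X.P j, Y.P j) (X.Q j, Y.Q j)) :
    (mergeData m X Y).Covered
      ((Finset.univ : Finset (Fin (List.length N))) ×ˢ keys m (Nat.log 2 m + 2) ×ˢ
        (Finset.univ : Finset (Fin 3)))
      (fun i => toMeasurable volume (crossSet m X Y c (N.get i.1) i.2.1 i.2.2)) 4 := by
  classical
  intro z hz al u v hI hg K hK hKz
  set D := mergeData m X Y with hD
  let A : Fin (List.length N) × PairKey × Fin 3 → Set ℝ := fun i =>
    crossSet m X Y c (N.get i.1) i.2.1 i.2.2
  let I' := ((Finset.univ : Finset (Fin (List.length N))) ×ˢ keys m (Nat.log 2 m + 2) ×ˢ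
        (Finset.univ : Finset (Fin 3))).filter fun i => z ∈ A i
  refine ⟨I', Finset.filter_subset _ _, fun i hi => subset_toMeasurable _ _
    (Finset.mem_filter.1 hi).2, ?_⟩
  have hmap : ∀ p ∈ K, (X.key p, Y.key p) ∈ keys m (Nat.log 2 m + 2) := fun p hp =>
    key_mem_keys hX hY (hI.lt p (hK hp))
  have hmap' : ∀ i ∈ I', i.2.1 ∈ keys m (Nat.log 2 m + 2) := fun i hi =>
    (Finset.mem_product.1 (Finset.mem_product.1 (Finset.mem_filter.1 hi).1).2).1
  -- Both sides are split by group, as the counting bound holds for each group separately.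
  rw [Finset.card_eq_sum_card_fiberwise hmap, Finset.card_eq_sum_card_fiberwise hmap',
    Finset.mul_sum]
  refine Finset.sum_le_sum fun g hgk => ?_
  -- A crossing within the quadrant gives its own abscissa. One beside the quadrant has a single
  -- positive coordinate, equal to `z`, and gives the end `(z, 0)` or `(0, z)` of the antidiagonal.
  let x : Fin (List.length N) × PairKey × Fin 3 → ℝ := fun i =>
    if i.2.2 = 0 then
      if h : ∃ w ∈ segment ℝ (N.get i.1).1 (N.get i.1).2, quadX (c g) g w + quadY (c g) g w = z then
        quadX (c g) g h.choose else 0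
    else if i.2.2 = 1 then z else 0
  refine (hI.card_le (g := g) hg (X := (I'.filter fun i => i.2.1 = g).image x)
    (fun p hp => ?_) ?_).trans (Nat.mul_le_mul_left 4 Finset.card_image_le)
  · obtain ⟨h1, h2⟩ := Finset.mem_filter.1 hp
    exact ⟨hK h1, h2, hKz p h1⟩
  · rintro t ht rfl hzt
    obtain ⟨s, hs, w, hw, hwb, hwz, hwx, hwy⟩ := exists_crossing hX hY hc ht (hN t ht) hz hzt
    obtain ⟨n, rfl⟩ := List.get_of_mem hs
    change D.key t ∈ _ at hgk
    have hmem : ∀ k : Fin 3, z ∈ crossSet m X Y c (N.get n) (D.key t) k →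
        x (n, D.key t, k) ∈ (I'.filter fun i => i.2.1 = D.key t).image x := by
      intro k hk
      refine Finset.mem_image_of_mem _ (Finset.mem_filter.2 ⟨Finset.mem_filter.2 ⟨?_, hk⟩, rfl⟩)
      simp only [Finset.mem_product, Finset.mem_univ, true_and, and_true]
      exact hgk
    change max (quadX (c (D.key t)) (D.key t) w) 0 + max (quadY (c (D.key t)) (D.key t) w) 0 = z
      at hwz
    change quadX (c (D.key t)) (D.key t) w ≤ D.u t at hwx
    change quadY (c (D.key t)) (D.key t) w ≤ D.v t at hwy
    have hu0 : 0 ≤ D.u t := abs_nonneg _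
    have hv0 : 0 ≤ D.v t := abs_nonneg _
    by_cases h1 : 0 ≤ quadX (c (D.key t)) (D.key t) w
    · by_cases h2 : 0 ≤ quadY (c (D.key t)) (D.key t) w
      · rw [max_eq_left h1, max_eq_left h2] at hwz
        have hex : ∃ w ∈ segment ℝ (N.get n).1 (N.get n).2,
          quadX (c (D.key t)) (D.key t) w + quadY (c (D.key t)) (D.key t) w = z := ⟨w, hw, hwz⟩
        have hx : x (n, D.key t, 0) = quadX (c (D.key t)) (D.key t) w := by
          simp only [x, if_true, dif_pos hex]
          exact quadX_eq_of_add_eq (hr _ hs) hex.choose_spec.1 hw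
            (hex.choose_spec.2.trans hwz.symm)
        refine ⟨x (n, D.key t, 0), by convert hmem 0 ⟨w, ⟨hw, hwb, h1, h2⟩, hwz⟩; rfl, ?_, ?_⟩ <;> rw [hx] <;> linarith
      · rw [max_eq_left h1, max_eq_right (not_le.1 h2).le, add_zero] at hwz
        have hx : x (n, D.key t, 1) = z := by simp [x]
        refine ⟨x (n, D.key t, 1), by convert hmem 1 ⟨w, ⟨hw, hwb⟩, hwz⟩; rfl, ?_, ?_⟩ <;> rw [hx] <;> linarith
    · have h2 : 0 < quadY (c (D.key t)) (D.key t) w := by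
        by_contra! h2
        rw [max_eq_right (not_le.1 h1).le, max_eq_right h2] at hwz
        linarith
      rw [max_eq_right (not_le.1 h1).le, max_eq_left h2.le, zero_add] at hwz
      have hx : x (n, D.key t, 2) = 0 := by simp [x]
      refine ⟨x (n, D.key t, 2), by convert hmem 2 ⟨w, ⟨hw, hwb⟩, hwz⟩; rfl, ?_, ?_⟩ <;> rw [hx] <;> linarith

theorem Network.length_eq_sum (N : Network) :
    N.length = ∑ i : Fin (List.length N), manhattan (N.get i).1 (N.get i).2 := by
  unfold Network.length
  conv_lhs => rw [← List.ofFn_get N, List.map_ofFn, List.sum_ofFn]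
  rfl

/-- The greedy network is an approximation of every network that connects all pairs. -/
theorem Reach.length_le (hX : X.Valid m) (hY : Y.Valid m) {al : Finset ℕ} {u v : ℕ → ℝ}
    {M : Network} (h : Reach (mergeData m X Y) al u v M)
    (hno : ∀ p q, ¬ (mergeData m X Y).Mergeable al p q) {N : Network} (hr : N.IsRectilinear)
    (hN : ∀ j < m, Crosses N (X.P j, Y.P j) (X.Q j, Y.Q j)) :
    M.length + ∑ p ∈ al, (u p + v p) ≤ 48 * ((Nat.log 2 m + 2 : ℕ) : ℝ) ^ 2 * N.length := by
  obtain ⟨c, hc⟩ := exists_centre hX hY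
  have hvol : ∀ (s : Pt × Pt) g k,
      volume (toMeasurable volume (crossSet m X Y c s g k)) ≤
      ENNReal.ofReal (manhattan s.1 s.2) * volume (paramSet s (box m X Y g)) := by
    intro s g k
    rw [measure_toMeasurable]
    exact volume_crossSet_le c s g k
  have htop : ∀ (s : Pt × Pt) g,
      ENNReal.ofReal (manhattan s.1 s.2) * volume (paramSet s (box m X Y g)) ≠ ⊤ :=
    fun s g => ENNReal.mul_ne_top ENNReal.ofReal_ne_top (volume_paramSet_ne_top _ _)
  have := h.cost_final (mergeData_valid hX hY) (mergeData_covered hX hY hc hr hN)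
    (fun i => measurableSet_toMeasurable _ _)
    (fun i => ne_top_of_le_ne_top (htop _ _) (hvol _ _ _)) hno
  refine this.trans ?_
  have hle : ∀ i : Fin (List.length N) × PairKey × Fin 3,
      volume.real (toMeasurable volume (crossSet m X Y c (N.get i.1) i.2.1 i.2.2)) ≤
        manhattan (N.get i.1).1 (N.get i.1).2 *
          volume.real (paramSet (N.get i.1) (box m X Y i.2.1)) := by
    intro i
    refine (ENNReal.toReal_mono (htop _ _) (hvol _ _ _)).trans_eq ?_
    rw [ENNReal.toReal_mul, ENNReal.toReal_ofReal (manhattan_nonneg _ _)]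
    rfl
  -- The factor 3 counts the kinds of crossings and `4 * K ^ 2` is the overlap of the boxes; the
  -- covering constant 4 then makes 48.
  have hsum : ∑ i ∈ (Finset.univ : Finset (Fin (List.length N))) ×ˢ
      keys m (Nat.log 2 m + 2) ×ˢ (Finset.univ : Finset (Fin 3)),
      volume.real (toMeasurable volume (crossSet m X Y c (N.get i.1) i.2.1 i.2.2)) ≤
      3 * (4 * ((Nat.log 2 m + 2 : ℕ) : ℝ) ^ 2) * N.length := by
    refine (Finset.sum_le_sum fun i _ => hle i).trans ?_
    rw [Finset.sum_product, Network.length_eq_sum, Finset.mul_sum]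
    refine Finset.sum_le_sum fun n _ => ?_
    rw [Finset.sum_product]
    simp only [Finset.sum_const, Finset.card_univ, Fintype.card_fin, nsmul_eq_mul]
    rw [← Finset.mul_sum, ← Finset.mul_sum]
    have h1 := sum_paramSet_le (m := m) (X := X) (Y := Y) (N.get n) (Nat.log 2 m + 2)
    have h2 := mul_le_mul_of_nonneg_left h1 (manhattan_nonneg (N.get n).1 (N.get n).2)
    unfold keys
    push_cast at h2 ⊢
    linarith
  have := mul_le_mul_of_nonneg_left hsum (by norm_num : (0 : ℝ) ≤ (4 : ℕ))
  push_cast at this ⊢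
  linarith

end

/-! ### The program: coordinates -/

/-- Equality test. -/
def Test.natEq (e f : NatExp) : Test := .and (.natLe e f) (.natLe f e)

/-- Strict comparison. -/
def Test.realLt (e f : RealExp) : Test := .not (.realLe f e)

@[simp] theorem Test.holds_natEq (s : Memory) (e f : NatExp) :
    (Test.natEq e f).Holds s ↔ e.eval s = f.eval s := by
  simp [Test.natEq, Test.Holds, le_antisymm_iff]

@[simp] theorem Test.holds_realLt (s : Memory) (e f : RealExp) :
    (Test.realLt e f).Holds s ↔ e.eval s < f.eval s := by
  simp [Test.realLt, Test.Holds]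

/-- The entry of a natural-number array at a scalar variable. -/
abbrev NatExp.at (a i : ℕ) : NatExp := .get a (.var i)

/-- The entry of a real array at a scalar variable. -/
abbrev RealExp.at (a i : ℕ) : RealExp := .get a (.var i)

/-- Sequential composition of a list of programs. -/
def Program.block : List Program → Program
  | [] => .skip
  | [P] => P
  | P :: Q :: l => .seq P (Program.block (Q :: l))

/-- Store the coordinates of all terminals in the array `a + 4`, and those of their partners in the
array `a + 6`. -/
def copyProgram (a : ℕ) : Program :=
  .forLoop 2 0 (.block [
    .setReal (a + 4) (.var 2) (.at a 2),
    .setReal (a + 4) (.add (.var 0) (.var 2)) (.at (a + 2) 2),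
    .setReal (a + 6) (.var 2) (.at (a + 2) 2),
    .setReal (a + 6) (.add (.var 0) (.var 2)) (.at a 2)])

/-- Compute the ranks of the current terminal and of its partner. -/
def rankProgram (a : ℕ) : Program :=
  .forLoop 3 1 (.seq
    (.ite (.realLt (.at (a + 4) 3) (.at (a + 4) 2)) (.setVar 5 (.add (.var 5) (.const 1))) .skip)
    (.ite (.realLt (.at (a + 4) 3) (.at (a + 6) 2)) (.setVar 6 (.add (.var 6) (.const 1))) .skip))

/-- Halve the two ranks until they agree, and count the steps. -/
def levelProgram : Program :=
  .while (.not (.natEq (.var 5) (.var 6))) (.block [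
    .setVar 5 (.half (.var 5)), .setVar 6 (.half (.var 6)), .setVar 7 (.add (.var 7) (.const 1))])

/-- Compute the node, the orientation, and the smaller coordinate of each pair. -/
def nodeProgram (a : ℕ) : Program :=
  .forLoop 2 1 (.block [
    .setVar 5 (.const 0), .setVar 6 (.const 0), .setVar 7 (.const 0),
    rankProgram a, levelProgram,
    .setNat (a + 11) (.var 2) (.var 7), .setNat (a + 13) (.var 2) (.var 5),
    .ite (.realLe (.at (a + 4) 2) (.at (a + 6) 2))
      (.seq (.setNat (a + 15) (.var 2) (.const 1)) (.setReal (a + 8) (.var 2) (.at (a + 4) 2)))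
      (.seq (.setNat (a + 15) (.var 2) (.const 0)) (.setReal (a + 8) (.var 2) (.at (a + 6) 2)))])

/-- Compute the separating coordinate of each pair, and its distance from the terminal. -/
def centreProgram (a : ℕ) : Program :=
  .forLoop 2 1 (.block [
    .setReal (a + 10) (.var 2) (.at (a + 8) 2),
    .forLoop 3 1 (.ite
      (.and (.natEq (.at (a + 11) 3) (.at (a + 11) 2))
        (.and (.natEq (.at (a + 13) 3) (.at (a + 13) 2))
          (.realLt (.at (a + 10) 2) (.at (a + 8) 3))))
      (.setReal (a + 10) (.var 2) (.at (a + 8) 3)) .skip),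
    .ite (.realLe (.at (a + 4) 2) (.at (a + 10) 2))
      (.setReal (a + 12) (.var 2) (.sub (.at (a + 10) 2) (.at (a + 4) 2)))
      (.setReal (a + 12) (.var 2) (.sub (.at (a + 4) 2) (.at (a + 10) 2)))])

theorem runs_copy (a : ℕ) (s : Memory) {n : ℕ} (hn : s.nat 0 0 = n) :
    Runs (copyProgram a) s (n * 6 + 2) fun s' => ∀ i < n,
      s'.real (a + 4) i = s.real a i ∧ s'.real (a + 4) (n + i) = s.real (a + 2) i ∧
      s'.real (a + 6) i = s.real (a + 2) i ∧ s'.real (a + 6) (n + i) = s.real a i := by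
  refine Runs.forLoop (T := 4) (fun k s' => ∀ i < k,
      s'.real (a + 4) i = s.real a i ∧ s'.real (a + 4) (n + i) = s.real (a + 2) i ∧
      s'.real (a + 6) i = s.real (a + 2) i ∧ s'.real (a + 6) (n + i) = s.real a i)
    (by simp [Program.block, Program.natWrites]) (by simp [Program.block, Program.natWrites]) hn
    (by simp) ?_
  intro k hk s' hF hi hI
  have h0 : s'.nat 0 0 = n := by
    rw [hF.nat 0 (by simp [Program.forLoop, Program.block, Program.natWrites]), hn]
  have h1 : s'.real a = s.real a :=
    hF.real a (by simp [Program.forLoop, Program.block, Program.realWrites])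
  have h2 : s'.real (a + 2) = s.real (a + 2) :=
    hF.real _ (by simp [Program.forLoop, Program.block, Program.realWrites])
  refine Runs.setReal_seq (Runs.setReal_seq (Runs.setReal_seq (Runs.setReal ?_)))
  intro i hik
  have : i < k ∨ i = k := by omega
  simp only [NatExp.eval, RealExp.eval, hi, h0, h1, h2, Memory.setReal_real, Memory.setReal_nat,
    Memory.setNat_real]
  rcases this with h | rfl
  · have := hI i h
    simp [this, h.ne, show i ≠ n + k by omega, show n + i ≠ k by omega]
  · simp [show n ≠ 0 by omega]

theorem rank_succ (k : ℕ) (P : ℕ → ℝ) (x : ℝ) [Decidable (P k < x)] :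
    rank (k + 1) P x = rank k P x + if P k < x then 1 else 0 := by
  unfold rank
  rw [Finset.range_add_one, Finset.filter_insert]
  split_ifs
  · rw [Finset.card_insert_of_notMem (by simp)]
  · rfl

theorem runs_rank (a : ℕ) (s : Memory) {m j : ℕ} (hm : s.nat 1 0 = m) (hj : s.nat 2 0 = j)
    (h5 : s.nat 5 0 = 0) (h6 : s.nat 6 0 = 0) :
    Runs (rankProgram a) s (m * 6 + 2) fun s' =>
      s'.nat 5 0 = rank m (s.real (a + 4)) (s.real (a + 4) j) ∧
      s'.nat 6 0 = rank m (s.real (a + 4)) (s.real (a + 6) j) := by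
  refine Runs.forLoop (T := 4) (fun k s' =>
      s'.nat 5 0 = rank k (s.real (a + 4)) (s.real (a + 4) j) ∧
      s'.nat 6 0 = rank k (s.real (a + 4)) (s.real (a + 6) j))
    (by simp [Program.natWrites]) (by simp [Program.natWrites]) hm
    (by simp [h5, h6, rank]) ?_
  rintro k hk s' hF hi ⟨I5, I6⟩
  have h2 : s'.nat 2 0 = j := by
    rw [hF.nat 2 (by simp [Program.forLoop, Program.natWrites]), hj]
  have hr : ∀ b, s'.real b = s.real b := fun b =>
    hF.real b (by simp [Program.forLoop, Program.realWrites])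
  refine Runs.seq (T := 2) (T' := 2) (Runs.ite (T := 1) (fun h => Runs.setNat ?_) (fun h => Runs.skip ?_))
  all_goals
    refine Runs.ite (T := 1) (fun h' => Runs.setNat ?_) (fun h' => Runs.skip ?_)
  all_goals
    simp [RealExp.eval, NatExp.eval, hi, h2, hr] at h h'
    simp [NatExp.eval, rank_succ, I5, I6, h, h', not_lt.2]

/-- While the two numbers differ, one of them is positive, so halving lowers their sum. -/
theorem runs_level (s : Memory) {A B : ℕ} (h5 : s.nat 5 0 = A) (h6 : s.nat 6 0 = B)
    (h7 : s.nat 7 0 = 0) :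
    Runs levelProgram s ((A + B) * 4 + 1) fun s' =>
      s'.nat 5 0 = A / 2 ^ s'.nat 7 0 ∧ s'.nat 5 0 = B / 2 ^ s'.nat 7 0 ∧
      ∀ l < s'.nat 7 0, A / 2 ^ l ≠ B / 2 ^ l := by
  refine (Runs.whileLoop (T := 3) (fun s' => s'.nat 5 0 = A / 2 ^ s'.nat 7 0 ∧
      s'.nat 6 0 = B / 2 ^ s'.nat 7 0 ∧ ∀ l < s'.nat 7 0, A / 2 ^ l ≠ B / 2 ^ l)
    (fun s' => s'.nat 5 0 + s'.nat 6 0) ?_ ?_).mono (by rw [h5, h6]) ?_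
  · rintro s' ⟨I5, I6, I7⟩ hne
    simp only [Test.Holds, Test.holds_natEq, NatExp.eval] at hne
    refine Runs.setNat_seq (Runs.setNat_seq (Runs.setNat ?_))
    simp [NatExp.eval]
    refine ⟨⟨?_, ?_, ?_⟩, by omega⟩
    · rw [I5, Nat.div_div_eq_div_mul, pow_succ]
    · rw [I6, Nat.div_div_eq_div_mul, pow_succ]
    · intro l hl
      rcases hl.lt_or_eq with hl | rfl
      · exact I7 l hl
      · rwa [← I5, ← I6]
  · simp [h5, h6, h7]
  · rintro s' - ⟨⟨I5, I6, I7⟩, hne⟩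
    simp only [Test.Holds, Test.holds_natEq, NatExp.eval, not_not] at hne
    exact ⟨I5, hne.trans I6, I7⟩

/-- The node, the orientation and the smaller coordinate of the pair `i` have been stored. -/
def NodeSpec (a m : ℕ) (P Q : ℕ → ℝ) (s : Memory) (i : ℕ) : Prop :=
  rank m P (P i) / 2 ^ s.nat (a + 11) i = s.nat (a + 13) i ∧
  rank m P (Q i) / 2 ^ s.nat (a + 11) i = s.nat (a + 13) i ∧
  (∀ l < s.nat (a + 11) i, rank m P (P i) / 2 ^ l ≠ rank m P (Q i) / 2 ^ l) ∧
  ((P i ≤ Q i ∧ s.nat (a + 15) i = 1) ∨ (¬ P i ≤ Q i ∧ s.nat (a + 15) i = 0)) ∧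
  s.real (a + 8) i = min (P i) (Q i)

theorem runs_node (a : ℕ) (s : Memory) {m : ℕ} (hm : s.nat 1 0 = m) :
    Runs (nodeProgram a) s (m * (m * 14 + 16) + 2) fun s' =>
      ∀ i < m, NodeSpec a m (s.real (a + 4)) (s.real (a + 6)) s' i := by
  refine Runs.forLoop (T := m * 14 + 14) (fun k s' => ∀ i < k,
      NodeSpec a m (s.real (a + 4)) (s.real (a + 6)) s' i)
    (by simp [Program.block, Program.natWrites, rankProgram, levelProgram, Program.forLoop])
    (by simp [Program.block, Program.natWrites, rankProgram, levelProgram, Program.forLoop]) hm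
    (by simp) ?_
  intro k hk s' hF hi hI
  have h1 : s'.nat 1 0 = m := by
    rw [hF.nat 1 (by simp [Program.block, Program.natWrites, rankProgram, levelProgram,
      Program.forLoop]), hm]
  have hP : s'.real (a + 4) = s.real (a + 4) :=
    hF.real _ (by simp [Program.block, Program.realWrites, rankProgram, levelProgram,
      Program.forLoop])
  have hQ : s'.real (a + 6) = s.real (a + 6) :=
    hF.real _ (by simp [Program.block, Program.realWrites, rankProgram, levelProgram,
      Program.forLoop])
  set P := s.real (a + 4)
  set Q := s.real (a + 6)
  refine (Runs.setNat_seq (Runs.setNat_seq (Runs.setNat_seq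
    (Runs.seq (T := m * 6 + 2) (T' := m * 8 + 7) ?_)))).mono (by omega) fun _ _ h => h
  refine (runs_rank a _ (m := m) (j := k) ?_ ?_ ?_ ?_).mono le_rfl ?_
  iterate 4 simp [NatExp.eval, h1, hi]
  intro s₁ F₁ h₁
  simp only [Memory.setNat_real, hP, hQ] at h₁
  refine (Runs.seq (T := m * 8 + 1) (T' := 5) ?_).mono (by omega) fun _ _ h => h
  have h7 : s₁.nat 7 0 = 0 := by
    rw [F₁.nat 7 (by simp [rankProgram, Program.forLoop, Program.natWrites])]
    simp [NatExp.eval]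
  refine (runs_level s₁ h₁.1 h₁.2 h7).mono ?_ ?_
  · have := rank_le m P (P k)
    have := rank_le m P (Q k)
    omega
  intro s₂ F₂ h₂
  have hN : ∀ b, 3 < b → b ≠ 5 → b ≠ 6 → b ≠ 7 → s₂.nat b = s'.nat b := by
    intro b hb3 hb5 hb6 hb7
    rw [F₂.nat b (by simp [levelProgram, Program.block, Program.natWrites, *]),
      F₁.nat b (by simp [rankProgram, Program.forLoop, Program.natWrites, *]; omega)]
    simp [*]
  have hR : ∀ b, s₂.real b = s'.real b := by
    intro b
    rw [F₂.real b (by simp [levelProgram, Program.block, Program.realWrites]),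
      F₁.real b (by simp [rankProgram, Program.forLoop, Program.realWrites])]
    simp
  have hi2 : s₂.nat 2 0 = k := by
    rw [F₂.nat 2 (by simp [levelProgram, Program.block, Program.natWrites]),
      F₁.nat 2 (by simp [rankProgram, Program.forLoop, Program.natWrites])]
    simp [NatExp.eval, hi]
  have n11 := hN (a + 11) (by omega) (by omega) (by omega) (by omega)
  have n13 := hN (a + 13) (by omega) (by omega) (by omega) (by omega)
  have n15 := hN (a + 15) (by omega) (by omega) (by omega) (by omega)
  refine Runs.setNat_seq (Runs.setNat_seq (Runs.ite (T := 2)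
      (fun h => Runs.setNat_seq (Runs.setReal ?_)) (fun h => Runs.setNat_seq (Runs.setReal ?_))))
  all_goals
    simp [Test.Holds, RealExp.eval, NatExp.eval, hi2, hR, hP, hQ] at h
    intro i hik
    rcases Nat.lt_succ_iff_lt_or_eq.1 hik with hlt | rfl
    · have := hI i hlt
      simpa [NodeSpec, NatExp.eval, RealExp.eval, hi2, hR, n11, n13, n15, hlt.ne] using this
    · have e := h₂.2.2
      simp only [NodeSpec]
      simp [NatExp.eval, RealExp.eval, hi2, hR, hP, hQ, ← h₂.1, ← h₂.2.1, h]
      first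
        | exact e
        | exact ⟨e, h.le⟩

/-- The separating coordinate of the pair `i` and its distance from the terminal have been
stored. -/
def CentreSpec (a m : ℕ) (lev anc : ℕ → ℕ) (P lo : ℕ → ℝ) (s : Memory) (i : ℕ) : Prop :=
  (∀ j < m, lev j = lev i → anc j = anc i → lo j ≤ s.real (a + 10) i) ∧
  (∃ j < m, lev j = lev i ∧ anc j = anc i ∧ s.real (a + 10) i = lo j) ∧
  s.real (a + 12) i = |P i - s.real (a + 10) i|

theorem runs_centre (a : ℕ) (s : Memory) {m : ℕ} (hm : s.nat 1 0 = m) :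
    Runs (centreProgram a) s (m * (m * 4 + 7) + 2) fun s' =>
      ∀ i < m, CentreSpec a m (s.nat (a + 11)) (s.nat (a + 13)) (s.real (a + 4)) (s.real (a + 8))
        s' i := by
  refine Runs.forLoop (T := m * 4 + 5) (fun k s' => ∀ i < k,
      CentreSpec a m (s.nat (a + 11)) (s.nat (a + 13)) (s.real (a + 4)) (s.real (a + 8)) s' i)
    (by simp [Program.block, Program.natWrites, Program.forLoop])
    (by simp [Program.block, Program.natWrites, Program.forLoop]) hm (by simp) ?_
  intro k hk s' hF hi hI
  have h1 : s'.nat 1 0 = m := by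
    rw [hF.nat 1 (by simp [Program.block, Program.natWrites, Program.forLoop]), hm]
  have n11 : s'.nat (a + 11) = s.nat (a + 11) :=
    hF.nat _ (by simp [Program.block, Program.natWrites, Program.forLoop])
  have n13 : s'.nat (a + 13) = s.nat (a + 13) :=
    hF.nat _ (by simp [Program.block, Program.natWrites, Program.forLoop])
  have r4 : s'.real (a + 4) = s.real (a + 4) :=
    hF.real _ (by simp [Program.block, Program.realWrites, Program.forLoop])
  have r8 : s'.real (a + 8) = s.real (a + 8) :=
    hF.real _ (by simp [Program.block, Program.realWrites, Program.forLoop])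
  set lev := s.nat (a + 11)
  set anc := s.nat (a + 13)
  set P := s.real (a + 4)
  set lo := s.real (a + 8)
  refine (Runs.setReal_seq (Runs.seq (T := m * 4 + 2) (T' := 2) ?_)).mono (by omega)
    fun _ _ h => h
  -- Running maximum of the left ends at the node of `k`, started with the left end of `k` itself.
  refine (Runs.forLoop (m := m) (T := 2) (fun l s'' =>
    (∀ i ≠ k, s''.real (a + 10) i = s'.real (a + 10) i) ∧
    (∀ j < l, lev j = lev k → anc j = anc k → lo j ≤ s''.real (a + 10) k) ∧
    (∃ j < m, lev j = lev k ∧ anc j = anc k ∧ s''.real (a + 10) k = lo j))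
    (by simp [Program.natWrites]) (by simp [Program.natWrites]) (by simp [h1]) ?_ ?_).mono
    (by omega) ?_
  · refine ⟨fun i hik => ?_, by simp, k, hk, rfl, rfl, ?_⟩
    · simp [NatExp.eval, hi, hik]
    · simp [NatExp.eval, RealExp.eval, hi, r8]
  · rintro l hl s₁ F₁ hl₁ ⟨I1, I2, I3⟩
    have g2 : s₁.nat 2 0 = k := by
      rw [F₁.nat 2 (by simp [Program.forLoop, Program.natWrites])]; simp [hi]
    have g11 : s₁.nat (a + 11) = lev := by
      rw [F₁.nat _ (by simp [Program.forLoop, Program.natWrites])]; simp [n11]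
    have g13 : s₁.nat (a + 13) = anc := by
      rw [F₁.nat _ (by simp [Program.forLoop, Program.natWrites])]; simp [n13]
    have g8 : s₁.real (a + 8) = lo := by
      rw [F₁.real _ (by simp [Program.forLoop, Program.realWrites])]; simp [r8]
    refine Runs.ite (T := 1) (fun h => Runs.setReal ?_) (fun h => Runs.skip ?_)
    all_goals
      simp only [Test.Holds, Test.holds_natEq, Test.holds_realLt, RealExp.eval, NatExp.eval, g2,
        g11, g13, g8, hl₁] at h
    · refine ⟨fun i hik => ?_, fun j hj h1 h2 => ?_, l, hl, h.1, h.2.1, ?_⟩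
      · simp [NatExp.eval, g2, hik, I1 i hik]
      · simp [NatExp.eval, RealExp.eval, g2, g8, hl₁]
        rcases Nat.lt_succ_iff_lt_or_eq.1 hj with hj | rfl
        · exact (I2 j hj h1 h2).trans h.2.2.le
        · rfl
      · simp [NatExp.eval, RealExp.eval, g2, g8, hl₁]
    · refine ⟨I1, fun j hj h1 h2 => ?_, I3⟩
      rcases Nat.lt_succ_iff_lt_or_eq.1 hj with hj | rfl
      · exact I2 j hj h1 h2
      · exact not_lt.1 fun h' => h ⟨h1, h2, h'⟩
  · rintro s₁ F₁ ⟨I1, I2, I3⟩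
    have g2 : s₁.nat 2 0 = k := by
      rw [F₁.nat 2 (by simp [Program.forLoop, Program.natWrites])]; simp [hi]
    have g4 : s₁.real (a + 4) = P := by
      rw [F₁.real _ (by simp [Program.forLoop, Program.realWrites])]; simp [r4]
    have g12 : s₁.real (a + 12) = s'.real (a + 12) := by
      rw [F₁.real _ (by simp [Program.forLoop, Program.realWrites])]; simp
    refine Runs.ite (T := 1) (fun h => Runs.setReal ?_) (fun h => Runs.setReal ?_)
    all_goals
      simp only [Test.Holds, RealExp.eval, NatExp.eval, g2, g4] at h
      intro i hik
      rcases Nat.lt_succ_iff_lt_or_eq.1 hik with hlt | rfl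
      · have := hI i hlt
        simpa [CentreSpec, NatExp.eval, g2, g12, hlt.ne, I1 i hlt.ne] using this
      · refine ⟨fun j hj h1 h2 => by simpa using I2 j hj h1 h2, by simpa using I3, ?_⟩
        simp only [NatExp.eval, RealExp.eval, g2, g4]
        simp
        first
          | rw [abs_sub_comm, abs_of_nonneg (by linarith)]
          | rw [abs_of_nonneg (by linarith)]

/-- Compute all data for one coordinate. -/
def axisProgram (a : ℕ) : Program :=
  .block [copyProgram a, nodeProgram a, centreProgram a]

/-- The data for one coordinate that are stored in the memory. -/
def Memory.axis (s : Memory) (a : ℕ) : Axis where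
  P := s.real (a + 4)
  Q := s.real (a + 6)
  lev := s.nat (a + 11)
  anc := s.nat (a + 13)
  C := s.real (a + 10)

/-- The array `bit` stores the orientation of the pairs. -/
def Axis.IsOrientation (A : Axis) (m : ℕ) (bit : ℕ → ℕ) : Prop :=
  ∀ i < m, (A.P i ≤ A.Q i ∧ bit i = 1) ∨ (¬ A.P i ≤ A.Q i ∧ bit i = 0)

theorem runs_axis (a : ℕ) (s : Memory) {n : ℕ} (h0 : s.nat 0 0 = n) (h1 : s.nat 1 0 = 2 * n) :
    Runs (axisProgram a) s
      (n * 6 + 2 + (2 * n * (2 * n * 14 + 16) + 2 + (2 * n * (2 * n * 4 + 7) + 2))) fun s' =>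
      (s'.axis a).Valid (2 * n) ∧
      (∀ i < n, (s'.axis a).P i = s.real a i ∧ (s'.axis a).P (n + i) = s.real (a + 2) i ∧
        (s'.axis a).Q i = s.real (a + 2) i ∧ (s'.axis a).Q (n + i) = s.real a i) ∧
      (s'.axis a).IsOrientation (2 * n) (s'.nat (a + 15)) ∧
      ∀ i < 2 * n, s'.real (a + 12) i = |(s'.axis a).P i - (s'.axis a).C i| := by
  refine Runs.seq ((runs_copy a s h0).mono le_rfl fun s₁ F₁ h₁ => ?_)
  refine Runs.seq ((runs_node a s₁ (m := 2 * n) ?_).mono le_rfl fun s₂ F₂ h₂ => ?_)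
  · rw [F₁.nat 1 (by simp [copyProgram, Program.block, Program.natWrites, Program.forLoop]), h1]
  have n1 : s₂.nat 1 0 = 2 * n := by
    rw [F₂.nat 1 (by simp [Program.block, Program.natWrites, Program.forLoop, nodeProgram,
      rankProgram, levelProgram]),
      F₁.nat 1 (by simp [copyProgram, Program.block, Program.natWrites, Program.forLoop]), h1]
  have p4 : s₂.real (a + 4) = s₁.real (a + 4) := F₂.real _ (by
    simp [Program.block, Program.realWrites, Program.forLoop, nodeProgram,
      rankProgram, levelProgram])
  have p6 : s₂.real (a + 6) = s₁.real (a + 6) := F₂.real _ (by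
    simp [Program.block, Program.realWrites, Program.forLoop, nodeProgram,
      rankProgram, levelProgram])
  refine (runs_centre a s₂ n1).mono le_rfl fun s₃ F₃ h₃ => ?_
  have q4 : s₃.real (a + 4) = s₂.real (a + 4) := F₃.real _ (by
    simp [Program.block, Program.realWrites, Program.forLoop, centreProgram])
  have q6 : s₃.real (a + 6) = s₂.real (a + 6) := F₃.real _ (by
    simp [Program.block, Program.realWrites, Program.forLoop, centreProgram])
  have q11 : s₃.nat (a + 11) = s₂.nat (a + 11) := F₃.nat _ (by
    simp [Program.block, Program.natWrites, Program.forLoop, centreProgram])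
  have q13 : s₃.nat (a + 13) = s₂.nat (a + 13) := F₃.nat _ (by
    simp [Program.block, Program.natWrites, Program.forLoop, centreProgram])
  have q15 : s₃.nat (a + 15) = s₂.nat (a + 15) := F₃.nat _ (by
    simp [Program.block, Program.natWrites, Program.forLoop, centreProgram])
  simp only [Memory.axis, Axis.IsOrientation, q4, q6, q11, q13, q15, p4, p6]
  rw [p4] at h₃
  refine ⟨⟨fun j hj => ?_, fun j hj => (h₂ j hj).1, fun j hj => (h₂ j hj).2.1,
    fun j hj => (h₂ j hj).2.2.1, fun i hi j hj hl ha => ?_, fun j hj => ?_⟩, h₁,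
    fun i hi => (h₂ i hi).2.2.2.1, fun i hi => (h₃ i hi).2.2⟩
  -- The partner coordinate is the first coordinate of the reversed item.
  · dsimp only at hj ⊢
    rcases lt_or_ge j n with hjn | hjn
    · exact ⟨n + j, by omega, by rw [(h₁ j hjn).2.1, (h₁ j hjn).2.2.1]⟩
    · obtain ⟨i, rfl⟩ := Nat.exists_eq_add_of_le hjn
      exact ⟨i, by omega, by rw [(h₁ i (by omega)).1, (h₁ i (by omega)).2.2.2]⟩
  · rw [← (h₂ i hi).2.2.2.2]
    exact (h₃ j hj).1 i hi hl ha
  · obtain ⟨i, hi, hl, ha, e⟩ := (h₃ j hj).2.1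
    exact ⟨i, hi, hl, ha, by rw [← (h₂ i hi).2.2.2.2]; exact e⟩

/-! ### The program: greedy merging -/

/-- Whether the items given by the variables `2` and `3` are mergeable. -/
def mergeTest : Test :=
  .and (.natEq (.at 10 2) (.const 1)) (.and (.natEq (.at 10 3) (.const 1))
    (.and (.not (.natEq (.var 2) (.var 3)))
      (.and (.natEq (.at 11 2) (.at 11 3)) (.and (.natEq (.at 12 2) (.at 12 3))
        (.and (.natEq (.at 13 2) (.at 13 3)) (.and (.natEq (.at 14 2) (.at 14 3))
          (.and (.natEq (.at 15 2) (.at 15 3)) (.natEq (.at 16 2) (.at 16 3)))))))))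

/-- Compare the items given by the variables `2` and `3` with the best pair found so far. -/
def candidateProgram : Program :=
  .block [
    .ite (.realLe (.at 12 2) (.at 12 3)) (.setRealVar 14 (.at 12 2)) (.setRealVar 14 (.at 12 3)),
    .ite (.realLe (.at 13 2) (.at 13 3)) (.setRealVar 15 (.at 13 2)) (.setRealVar 15 (.at 13 3)),
    .ite (.and mergeTest (.realLt (.var 18) (.add (.var 14) (.var 15))))
      (.block [.setVar 8 (.var 2), .setVar 9 (.var 3),
        .setRealVar 18 (.add (.var 14) (.var 15))]) .skip]

/-- Search for the best pair of mergeable items. -/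
def searchProgram : Program :=
  .block [.setVar 8 (.const 0), .setVar 9 (.const 0), .setRealVar 18 (.sub (.const 0) (.const 1)),
    .forLoop 2 1 (.forLoop 3 1 candidateProgram)]

/-- Merge the items given by the variables `8` and `9`. -/
def mergeProgram : Program :=
  .block [
    .ite (.realLe (.at 12 8) (.at 12 9))
      (.seq (.setRealVar 14 (.at 12 8)) (.setRealVar 16 (.at 4 8)))
      (.seq (.setRealVar 14 (.at 12 9)) (.setRealVar 16 (.at 4 9))),
    .ite (.realLe (.at 13 8) (.at 13 9))
      (.seq (.setRealVar 15 (.at 13 8)) (.setRealVar 17 (.at 5 8)))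
      (.seq (.setRealVar 15 (.at 13 9)) (.setRealVar 17 (.at 5 9))),
    .emit (.at 4 8) (.at 5 8) (.var 16) (.at 5 8),
    .emit (.var 16) (.at 5 8) (.var 16) (.var 17),
    .emit (.at 4 9) (.at 5 9) (.var 16) (.at 5 9),
    .emit (.var 16) (.at 5 9) (.var 16) (.var 17),
    .setReal 12 (.var 8) (.var 14), .setReal 13 (.var 8) (.var 15),
    .setReal 4 (.var 8) (.var 16), .setReal 5 (.var 8) (.var 17),
    .setNat 10 (.var 9) (.const 0)]

/-- Merge as long as possible. -/
def greedyProgram : Program :=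
  .forLoop 4 1 (.seq searchProgram (.ite (.natEq (.var 8) (.var 9)) .skip mergeProgram))

/-- Connect the active items with their centres. -/
def finishProgram : Program :=
  .forLoop 2 1 (.ite (.natEq (.at 10 2) (.const 1))
    (.seq (.emit (.at 4 2) (.at 5 2) (.at 10 2) (.at 5 2))
      (.emit (.at 10 2) (.at 5 2) (.at 10 2) (.at 11 2))) .skip)

/-- The memory contains the nodes, orientations and centres of the pairs. -/
structure Memory.Holds (s : Memory) (m : ℕ) (X Y : Axis) : Prop where
  size : s.nat 1 0 = m
  levX : s.nat 11 = X.lev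
  levY : s.nat 12 = Y.lev
  ancX : s.nat 13 = X.anc
  ancY : s.nat 14 = Y.anc
  bitX : X.IsOrientation m (s.nat 15)
  bitY : Y.IsOrientation m (s.nat 16)
  CX : s.real 10 = X.C
  CY : s.real 11 = Y.C

theorem Memory.Holds.congr {s s' : Memory} {m : ℕ} {X Y : Axis} (h : s.Holds m X Y)
    (hn : ∀ a ∈ [1, 11, 12, 13, 14, 15, 16], s'.nat a = s.nat a)
    (hr : ∀ a ∈ [10, 11], s'.real a = s.real a) : s'.Holds m X Y := by
  simp only [List.mem_cons, List.not_mem_nil, or_false, forall_eq_or_imp, forall_eq] at hn hr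
  obtain ⟨h1, h2, h3, h4, h5, h6, h7, h8, h9⟩ := h
  constructor <;> simp [*]

theorem Memory.Holds.frame {s s' : Memory} {m : ℕ} {X Y : Axis} (h : s.Holds m X Y) {P : Program}
    (hF : P.Frame s s') (hn : ∀ a ∈ [1, 11, 12, 13, 14, 15, 16], a ∉ P.natWrites)
    (hr : ∀ a ∈ [10, 11], a ∉ P.realWrites) : s'.Holds m X Y :=
  h.congr (fun a ha => hF.nat a (hn a ha)) (fun a ha => hF.real a (hr a ha))

/-- The array `10` marks the active items. -/
def Memory.Active (s : Memory) (m : ℕ) (al : Finset ℕ) : Prop :=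
  ∀ j < m, s.nat 10 j = 1 ↔ j ∈ al

variable {m : ℕ} {X Y : Axis} {al : Finset ℕ}

theorem Axis.IsOrientation.key_eq_iff {A : Axis} {bit : ℕ → ℕ} (h : A.IsOrientation m bit) {i j : ℕ}
    (hi : i < m) (hj : j < m) :
    A.key i = A.key j ↔ A.lev i = A.lev j ∧ A.anc i = A.anc j ∧ bit i = bit j := by
  have h1 := h i hi
  have h2 := h j hj
  simp only [Axis.key, Prod.mk.injEq, decide_eq_decide]
  rcases h1 with ⟨h1, h1'⟩ | ⟨h1, h1'⟩ <;> rcases h2 with ⟨h2, h2'⟩ | ⟨h2, h2'⟩ <;>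
    simp [h1, h1', h2, h2']

theorem mergeTest_holds {s : Memory} (h : s.Holds m X Y) (ha : s.Active m al) {i j : ℕ}
    (hi : s.nat 2 0 = i) (hj : s.nat 3 0 = j) (him : i < m) (hjm : j < m) :
    mergeTest.Holds s ↔ (mergeData m X Y).Mergeable al i j := by
  have h1 := h.bitX.key_eq_iff him hjm
  have h2 := h.bitY.key_eq_iff him hjm
  have h3 : (mergeData m X Y).key i = (mergeData m X Y).key j ↔
      X.key i = X.key j ∧ Y.key i = Y.key j := by
    change (X.key i, Y.key i) = (X.key j, Y.key j) ↔ _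
    rw [Prod.mk.injEq]
  rw [MergeData.Mergeable, h3, h1, h2]
  simp only [mergeTest, Test.Holds, Test.holds_natEq, NatExp.eval, hi, hj, ha i him, ha j hjm,
    h.levX, h.levY, h.ancX, h.ancY]
  tauto

theorem runs_candidate {s : Memory} (h : s.Holds m X Y) (ha : s.Active m al) {i j : ℕ}
    (hi : s.nat 2 0 = i) (hj : s.nat 3 0 = j) (him : i < m) (hjm : j < m) :
    Runs candidateProgram s 8 fun s' =>
      ((mergeData m X Y).Mergeable al i j ∧ s.real 18 0 < gain (s.real 12) (s.real 13) i j ∧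
        s'.nat 8 0 = i ∧ s'.nat 9 0 = j ∧ s'.real 18 0 = gain (s.real 12) (s.real 13) i j) ∨
      (((mergeData m X Y).Mergeable al i j → gain (s.real 12) (s.real 13) i j ≤ s.real 18 0) ∧
        s'.nat 8 0 = s.nat 8 0 ∧ s'.nat 9 0 = s.nat 9 0 ∧ s'.real 18 0 = s.real 18 0) := by
  have aux : ∀ (a b : ℕ) (s : Memory), b ≠ a → s.nat 2 0 = i → s.nat 3 0 = j →
      Runs (.ite (.realLe (.at a 2) (.at a 3)) (.setRealVar b (.at a 2))
        (.setRealVar b (.at a 3))) s 2 fun s' => s'.real b 0 = min (s.real a i) (s.real a j) := by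
    intro a b s hb hi hj
    refine Runs.ite (T := 1) (fun h => Runs.setReal ?_) (fun h => Runs.setReal ?_) <;>
      simp [Test.Holds, RealExp.eval, NatExp.eval, hi, hj] at h ⊢
    · exact h
    · exact h.le
  refine Runs.seq (T := 2) (T' := 6) ((aux 12 14 s (by decide) hi hj).mono le_rfl
    fun s₁ F₁ h₁ => ?_)
  have n₁ : s₁.nat = s.nat := funext fun a => F₁.nat a (by simp [Program.natWrites])
  have r13 : s₁.real 13 = s.real 13 := F₁.real _ (by decide)
  have r18 : s₁.real 18 = s.real 18 := F₁.real _ (by decide)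
  refine Runs.seq (T := 2) (T' := 4) ((aux 13 15 s₁ (by decide) (by rw [n₁, hi])
    (by rw [n₁, hj])).mono le_rfl fun s₂ F₂ h₂ => ?_)
  have n₂ : s₂.nat = s.nat := (funext fun a => F₂.nat a (by simp [Program.natWrites])).trans n₁
  have r14 : s₂.real 14 0 = min (s.real 12 i) (s.real 12 j) := by
    rw [F₂.real 14 (by decide), h₁]
  have q18 : s₂.real 18 = s.real 18 := (F₂.real _ (by decide)).trans r18
  have H₂ : s₂.Holds m X Y := h.congr (fun a _ => by rw [n₂]) (fun a ha' => by
    rw [F₂.real a (by revert a; decide), F₁.real a (by revert a; decide)])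
  have A₂ : s₂.Active m al := by rw [Memory.Active, n₂]; exact ha
  have ht := mergeTest_holds H₂ A₂ (by rw [n₂, hi]) (by rw [n₂, hj]) him hjm
  rw [r13] at h₂
  have hg : s₂.real 14 0 + s₂.real 15 0 = gain (s.real 12) (s.real 13) i j := by
    rw [r14, h₂, gain]
  refine Runs.ite (T := 3) (fun hh => ?_) (fun hh => ?_) <;>
    simp only [Test.Holds, Test.holds_realLt, RealExp.eval, NatExp.eval, ht, q18, hg] at hh
  · refine Runs.setNat_seq (Runs.setNat_seq (Runs.setReal (Or.inl ⟨hh.1, hh.2, ?_⟩)))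
    simp [NatExp.eval, RealExp.eval, n₂, hi, hj, hg]
  · refine (Runs.skip (Or.inr ⟨fun h' => ?_, ?_, ?_, ?_⟩)).mono (by omega) fun _ _ h => h
    · exact not_lt.1 fun h'' => hh ⟨h', h''⟩
    · rw [n₂]
    · rw [n₂]
    · rw [q18]

/-- The best pair among those in `S` has been found. -/
def Memory.Best (s : Memory) (D : MergeData) (al : Finset ℕ) (u v : ℕ → ℝ)
    (S : ℕ → ℕ → Prop) : Prop :=
  (∀ i j, S i j → D.Mergeable al i j → gain u v i j ≤ s.real 18 0) ∧
  ((s.nat 8 0 = s.nat 9 0 ∧ s.real 18 0 = -1) ∨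
    (D.Mergeable al (s.nat 8 0) (s.nat 9 0) ∧ s.real 18 0 = gain u v (s.nat 8 0) (s.nat 9 0)))

/-- Gains of active items are nonnegative, so the initial value -1 with equal indices survives only
if no pair is mergeable. -/
theorem runs_search {s : Memory} (h : s.Holds m X Y) (ha : s.Active m al) (hal : ∀ j ∈ al, j < m)
    (hu : ∀ j ∈ al, 0 ≤ s.real 12 j) (hv : ∀ j ∈ al, 0 ≤ s.real 13 j) :
    Runs searchProgram s (m * (m * 10 + 4) + 5) fun s' =>
      (s'.nat 8 0 = s'.nat 9 0 ∧ ∀ i j, ¬ (mergeData m X Y).Mergeable al i j) ∨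
      ((mergeData m X Y).Mergeable al (s'.nat 8 0) (s'.nat 9 0) ∧
        ∀ i j, (mergeData m X Y).Mergeable al i j → gain (s.real 12) (s.real 13) i j ≤
          gain (s.real 12) (s.real 13) (s'.nat 8 0) (s'.nat 9 0)) := by
  set D := mergeData m X Y
  set u := s.real 12
  set v := s.real 13
  refine Runs.setNat_seq (Runs.setNat_seq (Runs.setReal_seq ((Runs.forLoop (m := m)
    (T := m * 10 + 2) (fun k s' => s'.Best D al u v fun i _ => i < k) (by decide) (by decide)
    (by simp [h.size]) ⟨by simp, Or.inl ?_⟩ ?_).mono le_rfl ?_)))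
  · simp [NatExp.eval, RealExp.eval]
  · intro k hk s₁ F₁ hi hB
    have H₁ : s₁.Holds m X Y := (h.congr (by simp) (by simp)).frame F₁ (by decide) (by decide)
    have u₁ : s₁.real 12 = u := by rw [F₁.real 12 (by decide)]; simp [u]
    have v₁ : s₁.real 13 = v := by rw [F₁.real 13 (by decide)]; simp [v]
    have A₁ : s₁.nat 10 = s.nat 10 := by rw [F₁.nat 10 (by decide)]; simp
    refine (Runs.forLoop (m := m) (T := 8) (fun l s' => s'.Best D al u v fun i j =>
      i < k ∨ i = k ∧ j < l) (by decide) (by decide) H₁.size ?_ ?_).mono le_rfl ?_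
    · simpa [Memory.Best] using hB
    · intro l hl s₂ F₂ hj hB₂
      have H₂ : s₂.Holds m X Y := H₁.frame F₂ (by decide) (by decide)
      have u₂ : s₂.real 12 = u := by rw [F₂.real 12 (by decide), u₁]
      have v₂ : s₂.real 13 = v := by rw [F₂.real 13 (by decide), v₁]
      have A₂ : s₂.Active m al := by
        rw [Memory.Active, F₂.nat 10 (by decide), A₁]; exact ha
      have hi₂ : s₂.nat 2 0 = k := by rw [F₂.nat 2 (by decide), hi]
      refine (runs_candidate H₂ A₂ hi₂ hj hk hl).mono le_rfl fun s₃ F₃ h₃ => ?_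
      rw [u₂, v₂] at h₃
      obtain ⟨b1, b2⟩ := hB₂
      rcases h₃ with ⟨g1, g2, g3, g4, g5⟩ | ⟨g1, g2, g3, g4⟩
      · refine ⟨fun i j hij hm => ?_, Or.inr ?_⟩
        · simp only [Memory.setNat_real, g5]
          have : (i < k ∨ i = k ∧ j < l) ∨ (i = k ∧ j = l) := by omega
          rcases this with h' | ⟨rfl, rfl⟩
          · exact (b1 i j h' hm).trans g2.le
          · rfl
        · simpa [g3, g4, g5] using g1
      · refine ⟨fun i j hij hm => ?_, ?_⟩
        · simp only [Memory.setNat_real, g4]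
          have : (i < k ∨ i = k ∧ j < l) ∨ (i = k ∧ j = l) := by omega
          rcases this with h' | ⟨rfl, rfl⟩
          · exact b1 i j h' hm
          · exact g1 hm
        · simpa [g2, g3, g4] using b2
    · rintro s₂ - ⟨b1, b2⟩
      refine ⟨fun i j hij hm => ?_, by simpa using b2⟩
      have h2 := hal j hm.2.1
      exact b1 i j (by omega) hm
  · rintro s₁ - ⟨b1, b2⟩
    rcases b2 with ⟨b2, b3⟩ | ⟨b2, b3⟩
    · refine Or.inl ⟨b2, fun i j hm => ?_⟩
      have h1 := b1 i j (hal i hm.1) hm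
      have : 0 ≤ gain u v i j := add_nonneg (le_min (hu i hm.1) (hu j hm.2.1))
        (le_min (hv i hm.1) (hv j hm.2.1))
      linarith
    · exact Or.inr ⟨b2, fun i j hm => b3 ▸ b1 i j (hal i hm.1) hm⟩

variable {u v : ℕ → ℝ} {N : Network}

/-- The memory stores a state of the greedy algorithm. -/
structure Memory.Stores (s : Memory) (m : ℕ) (X Y : Axis) (al : Finset ℕ) (u v : ℕ → ℝ)
    (N : Network) : Prop where
  holds : s.Holds m X Y
  active : s.Active m al
  u_eq : ∀ j ∈ al, s.real 12 j = u j
  v_eq : ∀ j ∈ al, s.real 13 j = v j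
  x_eq : ∀ j ∈ al, s.real 4 j = (mergeData m X Y).cx j + (mergeData m X Y).sx j * u j
  y_eq : ∀ j ∈ al, s.real 5 j = (mergeData m X Y).cy j + (mergeData m X Y).sy j * v j
  out_eq : s.out = N
  reach : Reach (mergeData m X Y) al u v N

theorem Memory.Stores.frame {s s' : Memory} (h : s.Stores m X Y al u v N) {P : Program}
    (hF : P.Frame s s') (hn : ∀ a ∈ [1, 10, 11, 12, 13, 14, 15, 16], a ∉ P.natWrites)
    (hr : ∀ a ∈ [4, 5, 10, 11, 12, 13], a ∉ P.realWrites) (ho : P.emits = false) :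
    s'.Stores m X Y al u v N := by
  simp only [List.mem_cons, List.not_mem_nil, or_false, forall_eq_or_imp, forall_eq] at hn hr
  refine ⟨h.holds.frame hF (by simp [hn]) (by simp [hr]), ?_, ?_, ?_, ?_, ?_,
    (hF.out ho).trans h.out_eq, h.reach⟩
  · rw [Memory.Active, hF.nat 10 hn.2.1]; exact h.active
  · rw [hF.real 12 (by simp [hr])]; exact h.u_eq
  · rw [hF.real 13 (by simp [hr])]; exact h.v_eq
  · rw [hF.real 4 (by simp [hr])]; exact h.x_eq
  · rw [hF.real 5 (by simp [hr])]; exact h.y_eq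

/-- The machine cannot multiply by a sign, so the absolute coordinate `f (min ..)` is not computed
but copied from the item that attains the minimum. -/
theorem runs_select {a c b d i j : ℕ} {s : Memory} (hi : s.nat 8 0 = i) (hj : s.nat 9 0 = j)
    (hab : c ≠ b) (hbd : b ≠ d) {f : ℝ → ℝ} (hfi : s.real c i = f (s.real a i))
    (hfj : s.real c j = f (s.real a j)) :
    Runs (.ite (.realLe (.at a 8) (.at a 9))
      (.seq (.setRealVar b (.at a 8)) (.setRealVar d (.at c 8)))
      (.seq (.setRealVar b (.at a 9)) (.setRealVar d (.at c 9)))) s 3 fun s' =>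
      s'.real b 0 = min (s.real a i) (s.real a j) ∧
      s'.real d 0 = f (min (s.real a i) (s.real a j)) := by
  refine Runs.ite (T := 2) (fun h => Runs.setReal_seq (Runs.setReal ?_))
    (fun h => Runs.setReal_seq (Runs.setReal ?_))
  all_goals
    simp only [Test.Holds, RealExp.eval, NatExp.eval, hi, hj] at h
  · rw [min_eq_left h]
    simp [RealExp.eval, NatExp.eval, hi, hbd, hfi, hab]
  · rw [min_eq_right (not_le.1 h).le]
    simp [RealExp.eval, NatExp.eval, hj, hbd, hfj, hab]

theorem runs_merge {s : Memory} (hD : (mergeData m X Y).Valid) (h : s.Stores m X Y al u v N)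
    {i j : ℕ} (hi : s.nat 8 0 = i) (hj : s.nat 9 0 = j)
    (hij : (mergeData m X Y).Mergeable al i j)
    (hmax : ∀ p q, (mergeData m X Y).Mergeable al p q → gain u v p q ≤ gain u v i j) :
    Runs mergeProgram s 15 fun s' =>
      ∃ u' v' N', s'.Stores m X Y (al.erase j) u' v' N' := by
  have hI := h.reach.inv hD
  have hpos := hD.pos_congr i (hI.lt i hij.1) j (hI.lt j hij.2.1) hij.2.2.2
  set D := mergeData m X Y with hDdef
  have hx : ∀ a, D.cx j + D.sx j * a = D.cx i + D.sx i * a := fun a =>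
    (congrArg Prod.fst (congrFun (congrFun hpos a) 0)).symm
  have hy : ∀ b, D.cy j + D.sy j * b = D.cy i + D.sy i * b := fun b =>
    (congrArg Prod.snd (congrFun (congrFun hpos 0) b)).symm
  have xi := h.x_eq i hij.1
  have xj := h.x_eq j hij.2.1
  have yi := h.y_eq i hij.1
  have yj := h.y_eq j hij.2.1
  have ui := h.u_eq i hij.1
  have uj := h.u_eq j hij.2.1
  have vi := h.v_eq i hij.1
  have vj := h.v_eq j hij.2.1
  rw [← hDdef, hx] at xj
  rw [← hDdef, hy] at yj
  refine Runs.seq (T := 3) (T' := 12) ((runs_select (f := fun a => D.cx i + D.sx i * a) hi hj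
    (by decide) (by decide) (by rw [xi, ui]) (by rw [xj, uj])).mono le_rfl fun s₁ F₁ h₁ => ?_)
  have n₁ : s₁.nat = s.nat := funext fun a => F₁.nat a (by simp [Program.natWrites])
  have r₁ : ∀ a, a ≠ 14 → a ≠ 16 → s₁.real a = s.real a := fun a h1 h2 =>
    F₁.real a (by simp [Program.realWrites, h1, h2])
  refine Runs.seq (T := 3) (T' := 9) ((runs_select (f := fun a => D.cy i + D.sy i * a)
    (i := i) (j := j) (by rw [n₁, hi]) (by rw [n₁, hj])
    (by decide) (by decide) (by rw [r₁ 5 (by decide) (by decide), r₁ 13 (by decide) (by decide),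
      yi, vi]) (by rw [r₁ 5 (by decide) (by decide), r₁ 13 (by decide) (by decide), yj, vj])).mono
      le_rfl fun s₂ F₂ h₂ => ?_)
  have n₂ : s₂.nat = s.nat := (funext fun a => F₂.nat a (by simp [Program.natWrites])).trans n₁
  have r₂ : ∀ a, a < 14 → s₂.real a = s.real a := fun a h1 => by
    rw [F₂.real a (by simp [Program.realWrites]; omega), r₁ a (by omega) (by omega)]
  have o₂ : s₂.out = N := by rw [F₂.out rfl, F₁.out rfl, h.out_eq]
  have r14 : s₂.real 14 0 = min (u i) (u j) := by rw [F₂.real 14 (by decide), h₁.1, ui, uj]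
  have r16 : s₂.real 16 0 = D.cx i + D.sx i * min (u i) (u j) := by
    rw [F₂.real 16 (by decide), h₁.2, ui, uj]
  rw [r₁ 13 (by decide) (by decide), vi, vj] at h₂
  obtain ⟨r15, r17⟩ := h₂
  have r4 := r₂ 4 (by decide)
  have r5 := r₂ 5 (by decide)
  have r12 := r₂ 12 (by decide)
  have r13 := r₂ 13 (by decide)
  have H₂ : s₂.Holds m X Y := h.holds.congr (fun a _ => by rw [n₂])
    (fun a ha => r₂ a (by revert a; decide))
  refine Runs.emit_seq (Runs.emit_seq (Runs.emit_seq (Runs.emit_seq (Runs.setReal_seq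
    (Runs.setReal_seq (Runs.setReal_seq (Runs.setReal_seq (Runs.setNat ?_))))))))
  refine ⟨_, _, _, H₂.congr (by simp) (by simp), ?_, ?_, ?_, ?_, ?_, ?_, h.reach.step hij hmax⟩
  · intro k hk
    have := h.active k hk
    simp only [Memory.setNat_nat, if_true, Memory.setReal_nat, Memory.emit_nat, NatExp.eval, n₂,
      hj, Finset.mem_erase]
    rcases eq_or_ne k j with rfl | hkj
    · simp
    · simp [hkj, this]
  all_goals try
    intro k hk
    have hk' := Finset.mem_of_mem_erase hk
    rcases eq_or_ne k i with rfl | hki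
    · simp [NatExp.eval, RealExp.eval, n₂, hi, r14, r15, r16, r17, ← hDdef]
    · simp [NatExp.eval, n₂, hi, hki, r4, r5, r12, r13, h.u_eq k hk', h.v_eq k hk',
        h.x_eq k hk', h.y_eq k hk', ← hDdef]
  simp [NatExp.eval, RealExp.eval, n₂, hi, hj, r4, r5, r16, r17, o₂, xi, xj, yi, yj,
    MergeData.link, MergeData.pos, ← hDdef, hx, hy]

theorem gain_congr {u v u' v' : ℕ → ℝ} {i j : ℕ} (hui : u i = u' i) (huj : u j = u' j)
    (hvi : v i = v' i) (hvj : v j = v' j) : gain u v i j = gain u' v' i j := by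
  simp only [gain, hui, huj, hvi, hvj]

/-- A round either merges and loses one active item or finds that no merge is possible, and then all
later rounds are idle. Hence `m` rounds suffice. -/
theorem runs_round {s : Memory} (hD : (mergeData m X Y).Valid) (h : s.Stores m X Y al u v N)
    {r : ℕ} (hr : (∀ i j, ¬ (mergeData m X Y).Mergeable al i j) ∨ al.card + r ≤ m) :
    Runs (.seq searchProgram (.ite (.natEq (.var 8) (.var 9)) .skip mergeProgram)) s
      (m * (m * 10 + 4) + 21) fun s' => ∃ al' u' v' N', s'.Stores m X Y al' u' v' N' ∧
        ((∀ i j, ¬ (mergeData m X Y).Mergeable al' i j) ∨ al'.card + (r + 1) ≤ m) := by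
  have hI := h.reach.inv hD
  have hg : ∀ i j, (mergeData m X Y).Mergeable al i j →
      gain (s.real 12) (s.real 13) i j = gain u v i j := fun i j hij =>
    gain_congr (h.u_eq i hij.1) (h.u_eq j hij.2.1) (h.v_eq i hij.1) (h.v_eq j hij.2.1)
  refine Runs.seq (T := m * (m * 10 + 4) + 5) (T' := 16) ((runs_search h.holds h.active hI.lt
    (fun j hj => h.u_eq j hj ▸ hI.u_nonneg j hj) (fun j hj => h.v_eq j hj ▸ hI.v_nonneg j hj)).mono
    le_rfl fun s₁ F₁ h₁ => ?_)
  have S₁ := h.frame F₁ (by decide) (by decide) (by decide)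
  refine Runs.ite (T := 15) (fun he => ?_) (fun he => ?_) <;>
    simp only [Test.holds_natEq, NatExp.eval] at he
  · refine (Runs.skip ⟨al, u, v, N, S₁, Or.inl ?_⟩).mono (by omega) fun _ _ h => h
    rcases h₁ with h₁ | h₁
    · exact h₁.2
    · exact absurd he h₁.1.2.2.1
  · rcases h₁ with h₁ | ⟨h₁, hmax⟩
    · exact absurd h₁.1 he
    · refine (runs_merge hD S₁ rfl rfl h₁ fun p q hpq => ?_).mono le_rfl fun s₂ F₂ h₂ => ?_
      · rw [← hg _ _ hpq, ← hg _ _ h₁]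
        exact hmax p q hpq
      · obtain ⟨u', v', N', h₂⟩ := h₂
        refine ⟨_, u', v', N', h₂, Or.inr ?_⟩
        rw [Finset.card_erase_of_mem h₁.2.1]
        have := Finset.card_pos.2 ⟨_, h₁.2.1⟩
        rcases hr with hr | hr
        · exact absurd h₁ (hr _ _)
        · omega

theorem runs_greedy {s : Memory} (hD : (mergeData m X Y).Valid)
    (h : s.Stores m X Y (Finset.range m) (mergeData m X Y).u (mergeData m X Y).v []) :
    Runs greedyProgram s (m * (m * (m * 10 + 4) + 23) + 2) fun s' =>
      ∃ al u v N, s'.Stores m X Y al u v N ∧ ∀ i j, ¬ (mergeData m X Y).Mergeable al i j := by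
  have set4 : ∀ (s : Memory) k al u v N, s.Stores m X Y al u v N →
      (s.setNat 4 0 k).Stores m X Y al u v N := fun s k al u v N h =>
    ⟨h.holds.congr (by simp) (by simp), by simpa [Memory.Active] using h.active, h.u_eq, h.v_eq,
      h.x_eq, h.y_eq, h.out_eq, h.reach⟩
  refine (Runs.forLoop (m := m) (T := m * (m * 10 + 4) + 21) (fun r s' => ∃ al u v N,
    s'.Stores m X Y al u v N ∧ ((∀ i j, ¬ (mergeData m X Y).Mergeable al i j) ∨ al.card + r ≤ m))
    (by decide) (by decide) h.holds.size
    ⟨_, _, _, _, set4 _ _ _ _ _ _ h, Or.inr (by simp)⟩ ?_).mono le_rfl ?_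
  · rintro k hk s' - - ⟨al, u, v, N, hS, hr⟩
    refine (runs_round hD hS hr).mono le_rfl ?_
    rintro s'' - ⟨al, u, v, N, hS, hr⟩
    exact ⟨al, u, v, N, set4 _ _ _ _ _ _ hS, hr⟩
  · rintro s' - ⟨al, u, v, N, hS, hr⟩
    refine ⟨al, u, v, N, hS, fun i j hij => ?_⟩
    rcases hr with hr | hr
    · exact hr i j hij
    · have : al.card = 0 := by omega
      rw [Finset.card_eq_zero.1 this] at hij
      simp [MergeData.Mergeable] at hij

/-- The connections of the active items among the first `k` with their centres. -/
noncomputable def finishNetwork (D : MergeData) (al : Finset ℕ) (u v : ℕ → ℝ) : ℕ → Network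
  | 0 => []
  | k + 1 => finishNetwork D al u v k ++ if k ∈ al then D.link k (u k) (v k) 0 0 else []

theorem runs_finish {s : Memory} (h : s.Stores m X Y al u v N) :
    Runs finishProgram s (m * 5 + 2) fun s' =>
      s'.out = N ++ finishNetwork (mergeData m X Y) al u v m := by
  refine Runs.forLoop (T := 3) (fun k s' =>
    s'.out = N ++ finishNetwork (mergeData m X Y) al u v k) (by decide) (by decide) h.holds.size
    (by simp [h.out_eq, finishNetwork]) ?_
  intro k hk s' F hi hI
  have n10 := F.nat 10 (by decide)
  have r4 := F.real 4 (by decide)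
  have r5 := F.real 5 (by decide)
  have r10 := F.real 10 (by decide)
  have r11 := F.real 11 (by decide)
  have ha := h.active k hk
  refine Runs.ite (T := 2) (fun hh => Runs.emit_seq (Runs.emit ?_))
    (fun hh => (Runs.skip ?_).mono (T' := 2) (by omega) fun _ _ h => h) <;>
    simp only [Test.holds_natEq, NatExp.eval, hi, n10, ha] at hh
  · simp [finishNetwork, hh, MergeData.link, MergeData.pos, RealExp.eval, NatExp.eval, hi, hI,
      r4, r5, r10, r11, h.x_eq k hh, h.y_eq k hh, h.holds.CX, h.holds.CY, mergeData]
  · simp [finishNetwork, hh, hI]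

theorem finishNetwork_length {D : MergeData} (hD : D.Valid) (hI : MergeInv D al u v) (k : ℕ) :
    (finishNetwork D al u v k).length = ∑ j ∈ Finset.range k with j ∈ al, (u j + v j) := by
  induction k with
  | zero => simp [finishNetwork, Network.length]
  | succ k ih =>
    rw [finishNetwork, Network.length_append, ih, Finset.range_add_one, Finset.filter_insert]
    split_ifs with hk
    · rw [Finset.sum_insert (by simp),
        D.link_length hD (hI.lt k hk) (hI.u_nonneg k hk) (hI.v_nonneg k hk)]
      ring
    · simp [Network.length]

theorem finishNetwork_rectilinear (D : MergeData) (al : Finset ℕ) (u v : ℕ → ℝ) (k : ℕ) :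
    (finishNetwork D al u v k).IsRectilinear := by
  induction k with
  | zero => intro s hs; simp [finishNetwork] at hs
  | succ k ih =>
    intro s hs
    rw [finishNetwork, List.mem_append] at hs
    rcases hs with hs | hs
    · exact ih s hs
    · split_ifs at hs
      · exact D.link_rectilinear _ _ _ _ _ s hs
      · simp at hs

theorem link_subset_finishNetwork (D : MergeData) (u v : ℕ → ℝ) {j : ℕ} (hj : j ∈ al) :
    ∀ k, j < k → D.link j (u j) (v j) 0 0 ⊆ finishNetwork D al u v k := by
  intro k hk
  induction k with
  | zero => omega
  | succ k ih =>
    rw [finishNetwork]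
    rcases Nat.lt_succ_iff_lt_or_eq.1 hk with hk | rfl
    · exact List.Subset.trans (ih hk) (List.subset_append_left _ _)
    · rw [if_pos hj]
      exact List.subset_append_right _ _

/-- In the final network every terminal is connected with its centre. -/
theorem Reach.joined_centre {D : MergeData} (hD : D.Valid) (h : Reach D al u v N) {t : ℕ}
    (ht : t < D.m) :
    Joined (N ++ finishNetwork D al u v D.m) (D.pos t (D.u t) (D.v t)) (D.pos t 0 0)
      (D.u t + D.v t) := by
  obtain ⟨k, hk, hkt, hJ⟩ := h.joined hD ht
  have hI := h.inv hD
  have h1 := D.joined_link (N := N ++ finishNetwork D al u v D.m) hD (hI.lt k hk)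
    (List.Subset.trans (link_subset_finishNetwork D u v hk D.m (hI.lt k hk))
      (List.subset_append_right _ _))
    (hI.u_nonneg k hk) (hI.v_nonneg k hk)
  rw [hD.pos_congr k (hI.lt k hk) t ht hkt] at h1
  convert (hJ.mono (List.subset_append_left _ _)).trans h1 using 1
  ring

/-! ### The approximation algorithm -/

/-- Mark all items as active. -/
def activateProgram : Program := .forLoop 2 1 (.setNat 10 (.var 2) (.const 1))

/-- The approximation algorithm. -/
def approxProgram : Program :=
  .block [.setVar 1 (.add (.var 0) (.var 0)), axisProgram 0, axisProgram 1, activateProgram,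
    greedyProgram, finishProgram]

theorem runs_activate {s : Memory} {m : ℕ} (hm : s.nat 1 0 = m) :
    Runs activateProgram s (m * 3 + 2) fun s' => ∀ j < m, s'.nat 10 j = 1 := by
  refine Runs.forLoop (T := 1) (fun k s' => ∀ j < k, s'.nat 10 j = 1) (by decide) (by decide) hm
    (by simp) ?_
  intro k hk s' F hi hI
  refine Runs.setNat fun j hj => ?_
  rcases Nat.lt_succ_iff_lt_or_eq.1 hj with h | rfl
  · simp [NatExp.eval, hi, h.ne, hI j h]
  · simp [NatExp.eval, hi]

/-- Both orders of a pair have the same separating coordinate. -/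
theorem Axis.Valid.C_eq_of_swap {A : Axis} {m : ℕ} (h : A.Valid m) {i j : ℕ} (hi : i < m)
    (hj : j < m) (h1 : A.P i = A.Q j) (h2 : A.Q i = A.P j) : A.C i = A.C j := by
  have a1 := h.anc_P i hi
  have a2 := h.anc_Q i hi
  have a3 := h.anc_P j hj
  have a4 := h.anc_Q j hj
  have l1 := h.lev_min i hi
  have l2 := h.lev_min j hj
  rw [h1] at a1 l1
  rw [h2] at a2 l1
  -- The least level at which two ranks agree does not depend on their order.
  have hl : A.lev i = A.lev j := by
    rcases lt_trichotomy (A.lev i) (A.lev j) with hl | hl | hl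
    · exact absurd (a2.trans a1.symm) (l2 _ hl)
    · exact hl
    · exact absurd (a4.trans a3.symm) (l1 _ hl)
  exact h.C_congr hi hj hl (by rw [← a1, ← a4, hl])

/-- The common centre lies between the two terminals, so the distances to it add up. -/
theorem Axis.Valid.abs_sub_C_add {A : Axis} {m : ℕ} (h : A.Valid m) {i j : ℕ} (hi : i < m)
    (hj : j < m) (h1 : A.P i = A.Q j) (h2 : A.Q i = A.P j) :
    |A.P i - A.C i| + |A.P j - A.C j| = |A.P i - A.P j| := by
  have e := h.C_eq_of_swap hi hj h1 h2
  have b1 := h.min_le_C hi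
  have b2 := h.C_le_max hi
  rw [h2] at b1 b2
  rw [← e]
  rcases le_total (A.P i) (A.P j) with hle | hle
  · rw [min_eq_left hle] at b1
    rw [max_eq_right hle] at b2
    rw [abs_of_nonpos (by linarith), abs_of_nonneg (by linarith), abs_of_nonpos (by linarith)]
    ring
  · rw [min_eq_right hle] at b1
    rw [max_eq_left hle] at b2
    rw [abs_of_nonneg (by linarith), abs_of_nonpos (by linarith), abs_of_nonneg (by linarith)]
    ring

/-- A bound for the running time. -/
noncomputable def timeBound : Polynomial ℕ :=
  let n : Polynomial ℕ := Polynomial.X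
  let axis := n * 6 + 2 + (2 * n * (2 * n * 14 + 16) + 2 + (2 * n * (2 * n * 4 + 7) + 2))
  1 + (axis + (axis + (2 * n * 3 + 2 + (2 * n * (2 * n * (2 * n * 10 + 4) + 23) + 2 +
    (2 * n * 5 + 2)))))

/-- The data of both coordinates of all pairs of the instance `R`, where the item `n + i` is the
reverse of the item `i`. -/
structure Encodes (R : Instance) (X Y : Axis) : Prop where
  validX : X.Valid (2 * R.length)
  validY : Y.Valid (2 * R.length)
  fst : ∀ i (h : i < R.length), (X.P i, Y.P i) = R[i].1
  snd : ∀ i (h : i < R.length), (X.Q i, Y.Q i) = R[i].2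
  fst' : ∀ i (h : i < R.length), (X.P (R.length + i), Y.P (R.length + i)) = R[i].2
  snd' : ∀ i (h : i < R.length), (X.Q (R.length + i), Y.Q (R.length + i)) = R[i].1

section

variable {R : Instance}

theorem Encodes.crosses (h : Encodes R X Y) {M : Network} (hM : Feasible R M) :
    ∀ j < 2 * R.length, Crosses M (X.P j, Y.P j) (X.Q j, Y.Q j) := by
  intro j hj
  rcases lt_or_ge j R.length with hjn | hjn
  · rw [h.fst j hjn, h.snd j hjn]
    exact (hM.2 _ (List.getElem_mem hjn)).crosses
  · obtain ⟨i, rfl⟩ := Nat.exists_eq_add_of_le hjn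
    have hi : i < R.length := by omega
    rw [h.fst' i hi, h.snd' i hi]
    exact (hM.2 _ (List.getElem_mem hi)).crosses.symm

/-- The path from a terminal to the centre and the reversed path of the opposite item have total
length equal to the Manhattan distance, because the centre lies in the bounding box. -/
theorem Encodes.feasible (h : Encodes R X Y)
    (hr : Reach (mergeData (2 * R.length) X Y) al u v N) :
    Feasible R (N ++ finishNetwork (mergeData (2 * R.length) X Y) al u v (2 * R.length)) := by
  have hD := mergeData_valid h.validX h.validY
  refine ⟨fun s hs => ?_, fun r hrR => ?_⟩
  · rcases List.mem_append.1 hs with hs | hs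
    exacts [hr.isRectilinear s hs, finishNetwork_rectilinear _ _ _ _ _ s hs]
  · obtain ⟨i, hi, rfl⟩ := List.getElem_of_mem hrR
    have hi' : i < 2 * R.length := by omega
    have hj' : R.length + i < 2 * R.length := by omega
    have j1 := hr.joined_centre hD (t := i) hi'
    have j2 := hr.joined_centre hD (t := R.length + i) hj'
    rw [mergeData_pos_start h.validX h.validY hi', mergeData_pos_zero] at j1
    rw [mergeData_pos_start h.validX h.validY hj', mergeData_pos_zero] at j2
    have e1 := (h.fst i hi).trans (h.snd' i hi).symm
    have e2 := (h.snd i hi).trans (h.fst' i hi).symm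
    rw [Prod.mk.injEq] at e1 e2
    rw [← h.validX.C_eq_of_swap hi' hj' e1.1 e2.1,
      ← h.validY.C_eq_of_swap hi' hj' e1.2 e2.2] at j2
    refine Joined.mConnected ?_
    rw [← h.fst i hi, ← h.fst' i hi]
    have a1 := h.validX.abs_sub_C_add hi' hj' e1.1 e2.1
    have a2 := h.validY.abs_sub_C_add hi' hj' e1.2 e2.2
    have hd : manhattan (X.P i, Y.P i) (X.P (R.length + i), Y.P (R.length + i)) =
        (|X.P i - X.C i| + |Y.P i - Y.C i|) +
          (|X.P (R.length + i) - X.C (R.length + i)| +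
            |Y.P (R.length + i) - Y.C (R.length + i)|) := by
      simp only [manhattan]
      linarith
    rw [hd]
    exact j1.trans j2.symm

theorem Encodes.length_le (h : Encodes R X Y)
    (hr : Reach (mergeData (2 * R.length) X Y) al u v N)
    (hno : ∀ p q, ¬ (mergeData (2 * R.length) X Y).Mergeable al p q) {M : Network}
    (hM : Feasible R M) :
    Network.length (N ++ finishNetwork (mergeData (2 * R.length) X Y) al u v (2 * R.length)) ≤
      48 * ((Nat.log 2 (2 * R.length) + 2 : ℕ) : ℝ) ^ 2 * M.length := by
  have hD := mergeData_valid h.validX h.validY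
  have hI := hr.inv hD
  have := hr.length_le h.validX h.validY hno hM.1 (h.crosses hM)
  rw [Network.length_append, finishNetwork_length hD hI]
  convert this using 3
  ext j
  simp only [Finset.mem_filter, Finset.mem_range]
  exact ⟨fun hj => hj.2, fun hj => ⟨hI.lt j hj, hj⟩⟩

end

theorem runs_approx (R : Instance) :
    Runs approxProgram (initial R) (timeBound.eval R.length) fun s =>
      ∃ X Y al u v N, Encodes R X Y ∧ Reach (mergeData (2 * R.length) X Y) al u v N ∧
        (∀ p q, ¬ (mergeData (2 * R.length) X Y).Mergeable al p q) ∧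
        s.out = N ++ finishNetwork (mergeData (2 * R.length) X Y) al u v (2 * R.length) := by
  set n := R.length with hn
  have hT : timeBound.eval n = 1 +
      ((n * 6 + 2 + (2 * n * (2 * n * 14 + 16) + 2 + (2 * n * (2 * n * 4 + 7) + 2))) +
      ((n * 6 + 2 + (2 * n * (2 * n * 14 + 16) + 2 + (2 * n * (2 * n * 4 + 7) + 2))) +
      (2 * n * 3 + 2 + (2 * n * (2 * n * (2 * n * 10 + 4) + 23) + 2 + (2 * n * 5 + 2))))) := by
    simp [timeBound]
  rw [hT]
  refine Runs.seq (Runs.setNat (Runs.seq ((runs_axis 0 _ (n := n) ?_ ?_).mono le_rfl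
    fun s₁ F₁ h₁ => ?_)))
  · simp [initial, hn]
  · simp [initial, NatExp.eval, hn]; ring
  refine Runs.seq ((runs_axis 1 _ (n := n) ?_ ?_).mono le_rfl fun s₂ F₂ h₂ => ?_)
  · rw [F₁.nat 0 (by decide)]; simp [initial, hn]
  · rw [F₁.nat 1 (by decide)]; simp [initial, NatExp.eval, hn]; ring
  have hs₂ : s₂.nat 1 0 = 2 * n := by
    rw [F₂.nat 1 (by decide), F₁.nat 1 (by decide)]; simp [initial, NatExp.eval, hn]; ring
  refine Runs.seq ((runs_activate hs₂).mono le_rfl fun s₃ F₃ h₃ => ?_)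
  set X := s₁.axis 0 with hX
  set Y := s₂.axis 1 with hY
  obtain ⟨vX, cX, oX, uX⟩ := h₁
  obtain ⟨vY, cY, oY, uY⟩ := h₂
  have hE : Encodes R X Y := by
    have r1 : s₁.real 1 = (initial R).real 1 := F₁.real 1 (by decide)
    have r3 : s₁.real 3 = (initial R).real 3 := F₁.real 3 (by decide)
    refine ⟨vX, vY, fun i h => ?_, fun i h => ?_, fun i h => ?_, fun i h => ?_⟩
    · rw [(cX i h).1, (cY i h).1, r1]; simp [initial, h]
    · rw [(cX i h).2.2.1, (cY i h).2.2.1, r3]; simp [initial, h]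
    · rw [← hn, (cX i h).2.1, (cY i h).2.1, r3]; simp [initial, h]
    · rw [← hn, (cX i h).2.2.2, (cY i h).2.2.2, r1]; simp [initial, h]
  -- The arrays of the two coordinates are interleaved, so the second run of `axisProgram` leaves
  -- the results of the first intact.
  have kn : ∀ a ∈ [11, 13, 15], s₃.nat a = s₁.nat a := fun a ha => by
    rw [F₃.nat a (by revert a; decide), F₂.nat a (by revert a; decide)]
  have kr : ∀ a ∈ [4, 10, 12], s₃.real a = s₁.real a := fun a ha => by
    rw [F₃.real a (by revert a; decide), F₂.real a (by revert a; decide)]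
  have ln : ∀ a ∈ [12, 14, 16], s₃.nat a = s₂.nat a := fun a ha =>
    F₃.nat a (by revert a; decide)
  have lr : ∀ a, s₃.real a = s₂.real a := fun a => F₃.real a (by
    simp [activateProgram, Program.forLoop, Program.realWrites])
  have hH : s₃.Holds (2 * n) X Y := by
    refine ⟨?_, kn 11 (by decide), ln 12 (by decide), kn 13 (by decide), ln 14 (by decide), ?_, ?_,
      kr 10 (by decide), lr 11⟩
    · rw [F₃.nat 1 (by decide), hs₂]
    · rw [kn 15 (by decide)]; exact oX
    · rw [ln 16 (by decide)]; exact oY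
  have hD := mergeData_valid vX vY
  have hS : s₃.Stores (2 * n) X Y (Finset.range (2 * n)) (mergeData (2 * n) X Y).u
      (mergeData (2 * n) X Y).v [] := by
    refine ⟨hH, fun j hj => by simp [h₃ j hj, hj], fun j hj => ?_, fun j hj => ?_, fun j hj => ?_,
      fun j hj => ?_, ?_, .init⟩
    · rw [kr 12 (by decide)]; exact uX j (Finset.mem_range.1 hj)
    · rw [lr 13]; exact uY j (Finset.mem_range.1 hj)
    · have := congrArg Prod.fst (mergeData_pos_start vX vY (Finset.mem_range.1 hj))
      rw [kr 4 (by decide)]; exact this.symm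
    · have := congrArg Prod.snd (mergeData_pos_start vX vY (Finset.mem_range.1 hj))
      rw [lr 5]; exact this.symm
    · rw [F₃.out (by decide), F₂.out (by decide), F₁.out (by decide)]; rfl
  refine Runs.seq ((runs_greedy hD hS).mono le_rfl fun s₄ F₄ h₄ => ?_)
  obtain ⟨al, u, v, N, h₄, hno⟩ := h₄
  exact (runs_finish h₄).mono le_rfl fun s₅ _ h₅ => ⟨X, Y, al, u, v, N, hE, h₄.reach, hno, h₅⟩

/-- The approximation ratio. -/
noncomputable def ratio (n : ℕ) : ℝ := 48 * ((Nat.log 2 (2 * n) + 2 : ℕ) : ℝ) ^ 2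

theorem ratio_isBigO : ratio =O[atTop] fun n : ℕ => Real.log (n : ℝ) ^ 2 := by
  refine IsBigO.of_bound (48 * (4 / Real.log 2) ^ 2) ?_
  filter_upwards [eventually_ge_atTop 2] with n hn
  have h2 : 0 < Real.log 2 := Real.log_pos (by norm_num)
  have hlog : Real.log 2 ≤ Real.log n := Real.log_le_log (by norm_num) (by exact_mod_cast hn)
  -- For `n ≥ 2` the left side is `Nat.log 2 n + 3`, where `Nat.log 2 n` and 1 are each at most `log
  -- n / log 2`.
  have h1 : ((Nat.log 2 (2 * n) + 2 : ℕ) : ℝ) ≤ 4 / Real.log 2 * Real.log n := by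
    have h3 : Nat.log 2 (2 * n) = Nat.log 2 n + 1 := by
      rw [mul_comm, Nat.log_mul_base (by norm_num) (by omega)]
    have h4 : (Nat.log 2 n : ℝ) * Real.log 2 ≤ Real.log n := by
      rw [← Real.log_pow]
      refine Real.log_le_log (by positivity) ?_
      exact_mod_cast Nat.pow_log_le_self 2 (by omega)
    rw [h3, div_mul_eq_mul_div, le_div_iff₀ h2]
    push_cast
    linarith
  rw [Real.norm_of_nonneg (by unfold ratio; positivity), Real.norm_of_nonneg (by positivity), ratio,
    mul_assoc, ← mul_pow]
  gcongr

theorem admitsApproximation_ratio : AdmitsApproximation ratio := by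
  refine ⟨approxProgram, timeBound, fun R => ?_⟩
  obtain ⟨s, k, he, hk, X, Y, al, u, v, N, hE, hr, hno, ho⟩ := runs_approx R
  exact ⟨s, k, he, hk, ho ▸ hE.feasible hr, fun M hM => ho ▸ hE.length_le hr hno hM⟩

end GMMN

theorem mainTheorem5 :
    ∃ ρ : ℕ → ℝ, (ρ =O[atTop] fun n : ℕ => Real.log (n : ℝ) ^ 2) ∧
      GMMN.AdmitsApproximation ρ :=
  ⟨GMMN.ratio, GMMN.ratio_isBigO, GMMN.admitsApproximation_ratio⟩
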